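/- Fix an integer $d\ge 3$. For a prime $q$ let $S^{d-2}(\mathbb Z/q\mathbb Z)\subset S^d(\mathbb Z/q\mathbb Z)$ be the set of all $\vec a=(a_0,\dots,a_{d-2},0,0)\in(\mathbb Z/q\mathbb Z)^{d+1}$ with $a_0^2+\dots+a_{d-2}^2=1$. For such an $\vec a$ put $$\mathcal L(\vec a)=\{(x_0,\dots,x_{d-2})\in\mathbb Z^{d-1}: x_0a_0+\dots+x_{d-2}a_{d-2}\equiv 0 \bmod q\},\qquad \eta(\vec a)=\log_q\min_B M(B),$$ where $B=\{\vec v_1,\dots,\vec v_{d-1}\}$ runs over all $\mathbb Z$-bases of $\mathcal L(\vec a)$ and $M(B)=\max_i|\vec v_i|$ is the largest Euclidean norm of a vector of $B$. There are a deterministic algorithm (depending only on $d$) and constants $k$, $K_d$, $C_d$ (depending only on $d$) such that for every prime $q$ and every $\vec a\in S^{d-2}(\mathbb Z/q\mathbb Z)\subset S^d(\mathbb Z/q\mathbb Z)$ the algorithm, on input $q$ and the residues in $\{0,\dots,q-1\}$ of the coordinates of $\vec a$, halts after at most $K_d(\log q)^k$ bit operations and returns a rational number $y$ with $$|y-\eta(\vec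 a)|\le \frac{C_d}{\log q}.$$ Here an algorithm is a fixed finite program on integer registers with assignments of constants, $+$, $-$, $\times$, integer division, sequencing, branching and while-loops on the sign of a register. Its bit operations are counted by charging an arithmetic operation on $x,y$ with $b(x)b(y)$, and the writing of a constant $x$ or the sign test of $x$ with $b(x)$, where $b(x)$ is the number of bits of $x$ including a sign bit; the empty instruction costs $1$. -/

import Mathlib

noncomputable section

namespace LabelAlgorithm

/-! ### Spheres over a commutative ring -/

/-- The points `(x₀, …, x_d)` with `x₀² + ⋯ + x_d² = 1`. -/
def sphere (d : ℕ) (R : Type*) [CommRing R] : Set (Fin (d + 1) → R) :=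
  {x | ∑ i, x i ^ 2 = 1}

/-- The copy of `S^{d-2}(R)` inside `S^d(R)`: the points `(x₀, …, x_{d-2}, 0, 0)` of `S^d(R)`. -/
def subsphere (d : ℕ) (R : Type*) [CommRing R] : Set (Fin (d + 1) → R) :=
  {x | x ∈ sphere d R ∧ ∀ i : Fin (d + 1), d - 1 ≤ (i : ℕ) → x i = 0}

/-! ### The lattice and its height -/

variable {d q : ℕ}

/-- The lattice of all `(x₀, …, x_{d-2}) ∈ ℤ^{d-1}` with
`x₀ a₀ + ⋯ + x_{d-2} a_{d-2} ≡ 0 mod q`. -/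
def lattice (a : Fin (d + 1) → ZMod q) : Submodule ℤ (Fin (d - 1) → ℤ) where
  carrier := {x | ∑ i : Fin (d - 1), (x i : ZMod q) * a (Fin.castLE (by omega) i) = 0}
  zero_mem' := by simp
  add_mem' := by
    intro x y hx hy
    simp only [Set.mem_ofPred_eq] at hx hy ⊢
    simp [add_mul, Finset.sum_add_distrib, hx, hy]
  smul_mem' := by
    intro c x hx
    simp only [Set.mem_ofPred_eq] at hx ⊢
    simp [mul_assoc, ← Finset.mul_sum, hx]

/-- The Euclidean norm of an integer vector. -/
def euclideanNorm {n : ℕ} (v : Fin n → ℤ) : ℝ :=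
  ‖WithLp.toLp 2 (fun j => (v j : ℝ))‖

/-- `M(B)`, the largest Euclidean norm of a vector of the basis `B`. -/
def basisHeight {a : Fin (d + 1) → ZMod q} (B : Module.Basis (Fin (d - 1)) ℤ (lattice a)) : ℝ :=
  ⨆ i, euclideanNorm (B i : Fin (d - 1) → ℤ)

/-- `min_B M(B)` over all `ℤ`-bases `B` of the lattice; see `isLeast_minHeight`. -/
def minHeight (a : Fin (d + 1) → ZMod q) : ℝ :=
  sInf (Set.range fun B : Module.Basis (Fin (d - 1)) ℤ (lattice a) => basisHeight B)

/-- The height `η(a) = log_q min_B M(B)`. -/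
def eta (a : Fin (d + 1) → ZMod q) : ℝ :=
  Real.logb q (minHeight a)

theorem nonempty_basis (hq : q ≠ 0) (a : Fin (d + 1) → ZMod q) :
    Nonempty (Module.Basis (Fin (d - 1)) ℤ (lattice a)) := by
  have hle : Module.finrank ℤ (lattice a) ≤ d - 1 := by
    simpa using Submodule.finrank_le (lattice a)
  have hmem : ∀ x : Fin (d - 1) → ℤ, (q : ℤ) • x ∈ lattice a := by
    intro x
    change ∑ i : Fin (d - 1), (((q : ℤ) • x) i : ZMod q) * _ = 0
    simp
  let f : (Fin (d - 1) → ℤ) →ₗ[ℤ] lattice a :=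
    { toFun := fun x => ⟨(q : ℤ) • x, hmem x⟩
      map_add' := fun x y => Subtype.ext (smul_add _ _ _)
      map_smul' := fun c x => Subtype.ext (smul_comm _ _ _) }
  have hf : Function.Injective f := by
    intro x y h
    have h' : (q : ℤ) • x = (q : ℤ) • y := congrArg Subtype.val h
    exact smul_right_injective _ (by exact_mod_cast hq) h'
  have hge : d - 1 ≤ Module.finrank ℤ (lattice a) := by
    simpa using LinearMap.finrank_le_finrank_of_injective hf
  exact ⟨Module.finBasisOfFinrankEq ℤ (lattice a) (le_antisymm hle hge)⟩

/-- For `d ≥ 2` and `q ≠ 0` the infimum in `minHeight` is a minimum. -/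
theorem isLeast_minHeight (hd : 2 ≤ d) (hq : q ≠ 0) (a : Fin (d + 1) → ZMod q) :
    IsLeast (Set.range fun B : Module.Basis (Fin (d - 1)) ℤ (lattice a) => basisHeight B)
      (minHeight a) := by
  have hne := nonempty_basis hq a
  have : Nonempty (Fin (d - 1)) := ⟨⟨0, by omega⟩⟩
  have key : ∀ B : Module.Basis (Fin (d - 1)) ℤ (lattice a),
      ∃ n : ℕ, Real.sqrt n = basisHeight B := by
    intro B
    obtain ⟨i, hi⟩ := exists_eq_ciSup_of_finite
      (f := fun i => euclideanNorm (B i : Fin (d - 1) → ℤ))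
    refine ⟨∑ j, ((B i : Fin (d - 1) → ℤ) j).natAbs ^ 2, ?_⟩
    rw [basisHeight, ← hi, euclideanNorm, EuclideanSpace.norm_eq]
    congr 1
    push_cast
    refine Finset.sum_congr rfl fun j _ => ?_
    simp [Nat.cast_natAbs]
  choose n hn using key
  obtain ⟨B₀, hB₀⟩ : ∃ B₀, ∀ B, n B₀ ≤ n B := by
    have := Function.argmin_le n
    exact ⟨Function.argmin n, fun B => this B⟩
  have hleast : IsLeast
      (Set.range fun B : Module.Basis (Fin (d - 1)) ℤ (lattice a) => basisHeight B)
      (basisHeight B₀) := by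
    refine ⟨⟨B₀, rfl⟩, ?_⟩
    rintro _ ⟨B, rfl⟩
    simp only [← hn]
    exact Real.sqrt_le_sqrt (by exact_mod_cast hB₀ B)
  rw [minHeight, hleast.csInf_eq]
  exact hleast

/-! ### Deterministic algorithms and their bit complexity

The machine is the random access machine with logarithmic cost, without indirect addressing:
a fixed finite program acts on integer registers, and every instruction is charged the
number of bit operations of the schoolbook methods. A program mentions only finitely many
registers; a multitape Turing machine simulates it with polynomial overhead. -/

/-- The four arithmetic operations on integers. -/
inductive ArithOp where
  | add
  | sub
  | mul
  | div

/-- The value of an operation. `div` is division with remainder, with `x / 0 = 0`. -/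
def ArithOp.eval : ArithOp → ℤ → ℤ → ℤ
  | .add, x, y => x + y
  | .sub, x, y => x - y
  | .mul, x, y => x * y
  | .div, x, y => x / y

/-- Programs over registers `0, 1, 2, …`. -/
inductive Program where
  /-- do nothing -/
  | skip
  /-- `const r c`: put the constant `c` into register `r` -/
  | const (r : ℕ) (c : ℤ)
  /-- `arith op r x y`: put the result of `op` on the registers `x`, `y` into register `r` -/
  | arith (op : ArithOp) (r x y : ℕ)
  /-- one program after the other -/
  | seq (P Q : Program)
  /-- `cond r P Q`: if register `r` is positive then `P` else `Q` -/
  | cond (r : ℕ) (P Q : Program)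
  /-- `loop r P`: while register `r` is positive do `P` -/
  | loop (r : ℕ) (P : Program)

/-- The contents of the registers. -/
abbrev State := ℕ → ℤ

/-- The number of bits of an integer, including a sign bit. -/
def bits (x : ℤ) : ℕ := x.natAbs.size + 1

/-- `Runs P s t s'`: started on the register contents `s`, the program `P` halts, at total
cost `t`, with register contents `s'`. A constant or a sign test is charged the number of bits
of the integer written or read, an arithmetic operation the product of the numbers
of bits of its two operands. -/
inductive Runs : Program → State → ℕ → State → Prop
  | skip (s : State) : Runs .skip s 1 s
  | const (r : ℕ) (c : ℤ) (s : State) :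
      Runs (.const r c) s (bits c) (Function.update s r c)
  | arith (op : ArithOp) (r x y : ℕ) (s : State) :
      Runs (.arith op r x y) s (bits (s x) * bits (s y))
        (Function.update s r (op.eval (s x) (s y)))
  | seq {P Q : Program} {s s' s'' : State} {t t' : ℕ} :
      Runs P s t s' → Runs Q s' t' s'' → Runs (.seq P Q) s (t + t') s''
  | cond_pos {r : ℕ} {P Q : Program} {s s' : State} {t : ℕ} :
      0 < s r → Runs P s t s' → Runs (.cond r P Q) s (bits (s r) + t) s'
  | cond_nonpos {r : ℕ} {P Q : Program} {s s' : State} {t : ℕ} :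
      s r ≤ 0 → Runs Q s t s' → Runs (.cond r P Q) s (bits (s r) + t) s'
  | loop_pos {r : ℕ} {P : Program} {s s' s'' : State} {t t' : ℕ} :
      0 < s r → Runs P s t s' → Runs (.loop r P) s' t' s'' →
      Runs (.loop r P) s (bits (s r) + t + t') s''
  | loop_nonpos {r : ℕ} {P : Program} {s : State} :
      s r ≤ 0 → Runs (.loop r P) s (bits (s r)) s

/-- Programs are deterministic: the cost and the result are determined by the start. -/
theorem Runs.deterministic {P : Program} {s s₁ : State} {t₁ : ℕ} (h₁ : Runs P s t₁ s₁) :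
    ∀ {t₂ : ℕ} {s₂ : State}, Runs P s t₂ s₂ → t₁ = t₂ ∧ s₁ = s₂ := by
  induction h₁ with
  | skip s => intro t₂ s₂ h; cases h; exact ⟨rfl, rfl⟩
  | const r c s => intro t₂ s₂ h; cases h; exact ⟨rfl, rfl⟩
  | arith op r x y s => intro t₂ s₂ h; cases h; exact ⟨rfl, rfl⟩
  | seq _ _ ih ih' =>
    intro t₂ s₂ h
    cases h with
    | seq h h' =>
      obtain ⟨rfl, rfl⟩ := ih h
      obtain ⟨rfl, rfl⟩ := ih' h'
      exact ⟨rfl, rfl⟩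
  | cond_pos hp _ ih =>
    intro t₂ s₂ h
    cases h with
    | cond_pos _ h => obtain ⟨rfl, rfl⟩ := ih h; exact ⟨rfl, rfl⟩
    | cond_nonpos hn _ => omega
  | cond_nonpos hn _ ih =>
    intro t₂ s₂ h
    cases h with
    | cond_pos hp _ => omega
    | cond_nonpos _ h => obtain ⟨rfl, rfl⟩ := ih h; exact ⟨rfl, rfl⟩
  | loop_pos hp _ _ ih ih' =>
    intro t₂ s₂ h
    cases h with
    | loop_pos _ h h' =>
      obtain ⟨rfl, rfl⟩ := ih h
      obtain ⟨rfl, rfl⟩ := ih' h'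
      exact ⟨rfl, rfl⟩
    | loop_nonpos hn => omega
  | loop_nonpos hn =>
    intro t₂ s₂ h
    cases h with
    | loop_pos hp _ _ => omega
    | loop_nonpos _ => exact ⟨rfl, rfl⟩

/-- The input: `q` in register `0`, the residue in `{0, …, q - 1}` of `a_i` in register `i + 1`
for `0 ≤ i ≤ d`, and `0` in all other registers. -/
def input (a : Fin (d + 1) → ZMod q) : State
  | 0 => q
  | i + 1 => if h : i < d + 1 then ((a ⟨i, h⟩).val : ℤ) else 0

/-- `Returns P s t y`: started on `s`, the program `P` halts at total cost `t` and its output,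
the fraction with numerator in register `0` and positive denominator in register `1`, is `y`. -/
def Returns (P : Program) (s : State) (t : ℕ) (y : ℚ) : Prop :=
  ∃ s' : State, Runs P s t s' ∧ 0 < s' 1 ∧ y = (s' 0 : ℚ) / (s' 1 : ℚ)

end LabelAlgorithm

end

/-!
The algorithm is lattice basis reduction in the fixed dimension `d - 1`, and the output is a
quotient of bit lengths.

*The height up to a constant factor.* Let `b` be a basis of the lattice with Gram-Schmidt
orthogonalization `g`, and let `g_last` be the last vector of `g`. Every basis of the lattice has a
vector with a nonzero component along `g_last`; since this component is an integer multiple of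
`g_last`, the minimal height is at least `|g_last|` (`le_minHeight_sq`). If `b` is size-reduced and
satisfies Siegel's condition `|g_i|² ≤ 2 |g_{i+1}|²`, then all `|b_i|²` are at most a constant times
`|g_last|²` (`sum_sizeReduce_le`). For such a basis `X = ∑ |b_i|²` is the square of the minimal
height up to a constant factor, so `log X / (2 log q)` approximates `η` up to `O(1 / log q)`, and so
does the quotient `(size (X q) - size q) / (2 size q)` (`abs_size_div_size_sub_logb_le`).

*Polynomial time.* One round size-reduces all vectors and swaps two neighbours that violate Siegel's
condition. A swap multiplies the product of the Gram determinants of the initial segments by at most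
`3 / 4` (`potential_swap_le`); these determinants are positive integers, and initially their product
is at most a constant times a power of `q`, so there are `O(log q)` rounds. A size-reduced vector is bounded by the
orthogonalized vectors, so a round multiplies the lengths by at most a constant
(`reduceStep_dotProduct_self_le`), and all numbers keep `O(log q)` bits. A first basis is written
down with the inverse of a nonzero coordinate modulo `q`, which is its `(q - 2)`-th power
(`exists_program_basis`).

*Programs.* Each round is a simultaneous assignment of values that are `Definable`: they arise from
the variables by finitely many arithmetic operations and case distinctions. The dimension is fixed,
so this covers the Gram-Schmidt process over `ℚ` with rationals as pairs of integers. Such an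
assignment is a loop-free program of quadratic cost (`exists_program_assign`), and
`exists_program_loop` turns a round with an invariant that bounds the variables and the number of
remaining rounds into a while-loop.
-/

namespace LabelAlgorithm

/-! ### Programs for simultaneous assignments -/

/-- The functions of finitely many integer variables that a loop-free program can compute.
A predicate on functions rather than a type of expressions, so that no evaluation map is needed. -/
inductive Definable {V : Type} : ((V → ℤ) → ℤ) → Prop
  | var (v : V) : Definable fun σ => σ v
  | const (c : ℤ) : Definable fun _ => c
  | arith (op : ArithOp) {f g : (V → ℤ) → ℤ} :
      Definable f → Definable g → Definable fun σ => op.eval (f σ) (g σ)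
  | ite {f g h : (V → ℤ) → ℤ} :
      Definable f → Definable g → Definable h →
        Definable fun σ => if 0 < f σ then g σ else h σ

/-- All variables have at most `B` bits, not counting the sign. -/
def BitBounded {V : Type} (σ : V → ℤ) (B : ℕ) : Prop :=
  ∀ v, (σ v).natAbs < 2 ^ B

theorem bits_le_of_natAbs_lt {x : ℤ} {B : ℕ} (h : x.natAbs < 2 ^ B) : bits x ≤ B + 1 :=
  Nat.succ_le_succ (Nat.size_le.2 h)

theorem ArithOp.natAbs_eval_lt (op : ArithOp) {x y : ℤ} {B C : ℕ} (hx : x.natAbs < 2 ^ B)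
    (hy : y.natAbs < 2 ^ C) : (op.eval x y).natAbs < 2 ^ (B + C + 1) := by
  have hB : 2 ^ B ≤ 2 ^ (B + C) := Nat.pow_le_pow_right (by norm_num) (by omega)
  have hC : 2 ^ C ≤ 2 ^ (B + C) := Nat.pow_le_pow_right (by norm_num) (by omega)
  rw [pow_succ]
  cases op with
  | add => simp only [eval]; omega
  | sub => simp only [eval]; omega
  | mul =>
    have h : x.natAbs * y.natAbs < 2 ^ B * 2 ^ C := Nat.mul_lt_mul'' hx hy
    simp only [eval, Int.natAbs_mul]
    rw [← pow_add] at h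
    omega
  | div =>
    have h := Int.natAbs_ediv_le_natAbs x y
    simp only [eval]
    omega

/-- A fixed formula multiplies the number of bits by at most a constant. -/
theorem Definable.exists_bound {V : Type} {f : (V → ℤ) → ℤ} (hf : Definable f) :
    ∃ c : ℕ, ∀ (σ : V → ℤ) (B : ℕ), 1 ≤ B → BitBounded σ B → (f σ).natAbs < 2 ^ (c * B) := by
  induction hf with
  | var v => exact ⟨1, fun σ B _ h => by simpa using h v⟩
  | const c =>
    refine ⟨c.natAbs.size, fun σ B hB _ => ?_⟩
    exact (Nat.lt_size_self _).trans_le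
      (Nat.pow_le_pow_right (by norm_num) (Nat.le_mul_of_pos_right _ hB))
  | arith op _ _ ihf ihg =>
    obtain ⟨c, hc⟩ := ihf
    obtain ⟨c', hc'⟩ := ihg
    refine ⟨c + c' + 1, fun σ B hB h => ?_⟩
    refine (op.natAbs_eval_lt (hc σ B hB h) (hc' σ B hB h)).trans_le
      (Nat.pow_le_pow_right (by norm_num) ?_)
    nlinarith
  | ite _ _ _ _ ihg ihh =>
    obtain ⟨c, hc⟩ := ihg
    obtain ⟨c', hc'⟩ := ihh
    refine ⟨c + c', fun σ B hB h => ?_⟩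
    dsimp only
    split_ifs
    · exact (hc σ B hB h).trans_le (Nat.pow_le_pow_right (by norm_num) (by nlinarith))
    · exact (hc' σ B hB h).trans_le (Nat.pow_le_pow_right (by norm_num) (by nlinarith))

/-- A definable function is computed by a loop-free program in quadratic time. The variables are
kept in the registers `e v`, the value is put into the register `r`, and only registers from `r` on
are overwritten. -/
theorem Definable.exists_program {V : Type} {f : (V → ℤ) → ℤ} (hf : Definable f) (e : V → ℕ) :
    ∀ r, (∀ v, e v < r) → ∃ (P : Program) (c : ℕ), ∀ (σ : V → ℤ) (B : ℕ) (s : State), 1 ≤ B →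
      BitBounded σ B → (∀ v, s (e v) = σ v) → ∃ (t : ℕ) (s' : State),
        Runs P s t s' ∧ t ≤ c * B ^ 2 ∧ s' r = f σ ∧ ∀ i < r, s' i = s i := by
  induction hf with
  | var v =>
    intro r hr
    refine ⟨.seq (.const r 0) (.arith .add r (e v) r), 6, fun σ B s hB hσ hs => ?_⟩
    refine ⟨_, _, .seq (.const _ _ _) (.arith _ _ _ _ _), ?_, ?_, ?_⟩
    · have h := bits_le_of_natAbs_lt (hσ v)
      have h0 : bits 0 = 1 := by decide
      simp only [Function.update_self, Function.update_of_ne (hr v).ne, hs, h0]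
      nlinarith
    · simp [ArithOp.eval, Function.update_of_ne (hr v).ne, hs]
    · intro i hi
      simp [Function.update_of_ne hi.ne]
  | const c =>
    intro r hr
    refine ⟨.const r c, bits c, fun σ B s hB hσ hs => ⟨_, _, .const _ _ _, ?_, ?_, ?_⟩⟩
    · exact Nat.le_mul_of_pos_right _ (by positivity)
    · simp
    · intro i hi
      simp [Function.update_of_ne hi.ne]
  | @arith op f g hf hg ihf ihg =>
    intro r hr
    obtain ⟨P, c, hP⟩ := ihf r hr
    obtain ⟨Q, c', hQ⟩ := ihg (r + 1) (fun v => (hr v).trans (by omega))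
    obtain ⟨k, hk⟩ := hf.exists_bound
    obtain ⟨k', hk'⟩ := hg.exists_bound
    refine ⟨.seq P (.seq Q (.arith op r r (r + 1))), c + c' + (k + 1) * (k' + 1),
      fun σ B s hB hσ hs => ?_⟩
    obtain ⟨t, s₁, h₁, ht, hv, hi⟩ := hP σ B s hB hσ hs
    obtain ⟨t', s₂, h₂, ht', hv', hi'⟩ := hQ σ B s₁ hB hσ fun v => (hi _ (hr v)).trans (hs v)
    refine ⟨_, _, .seq h₁ (.seq h₂ (.arith _ _ _ _ _)), ?_, ?_, ?_⟩
    · rw [hv', hi' r (by omega), hv]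
      have := Nat.mul_le_mul (bits_le_of_natAbs_lt (hk σ B hB hσ))
        (bits_le_of_natAbs_lt (hk' σ B hB hσ))
      have h2 : (k * B + 1) * (k' * B + 1) ≤ ((k + 1) * B) * ((k' + 1) * B) :=
        Nat.mul_le_mul (by nlinarith) (by nlinarith)
      nlinarith
    · rw [Function.update_self, hv', hi' r (by omega), hv]
    · intro i h
      rw [Function.update_of_ne h.ne, hi' i (by omega), hi i h]
  | @ite f g h hf hg hh ihf ihg ihh =>
    intro r hr
    obtain ⟨P, c, hP⟩ := ihf r hr
    obtain ⟨Q, c', hQ⟩ := ihg r hr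
    obtain ⟨R, c'', hR⟩ := ihh r hr
    obtain ⟨k, hk⟩ := hf.exists_bound
    refine ⟨.seq P (.cond r Q R), c + (k + 1) + c' + c'', fun σ B s hB hσ hs => ?_⟩
    obtain ⟨t, s₁, h₁, ht, hv, hi⟩ := hP σ B s hB hσ hs
    have hb : bits (s₁ r) ≤ (k + 1) * B ^ 2 := by
      rw [hv]
      have := bits_le_of_natAbs_lt (hk σ B hB hσ)
      nlinarith
    have hs₁ : ∀ v, s₁ (e v) = σ v := fun v => (hi _ (hr v)).trans (hs v)
    by_cases hpos : 0 < f σ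
    · obtain ⟨t', s₂, h₂, ht', hv', hi'⟩ := hQ σ B s₁ hB hσ hs₁
      refine ⟨_, _, .seq h₁ (.cond_pos (by rwa [hv]) h₂), by nlinarith, ?_, ?_⟩
      · simp [hpos, hv']
      · intro i h
        rw [hi' i h, hi i h]
    · obtain ⟨t', s₂, h₂, ht', hv', hi'⟩ := hR σ B s₁ hB hσ hs₁
      refine ⟨_, _, .seq h₁ (.cond_nonpos (by rw [hv]; omega) h₂), by nlinarith, ?_, ?_⟩
      · simp [hpos, hv']
      · intro i h
        rw [hi' i h, hi i h]

/-- Started with the values `σ` in the registers `e v`, the program `P` halts at cost at most `T`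
with the values `τ` in these registers. -/
def Realizes {V : Type} (e : V → ℕ) (P : Program) (σ : V → ℤ) (T : ℕ) (τ : V → ℤ) : Prop :=
  ∀ s : State, (∀ v, s (e v) = σ v) →
    ∃ (t : ℕ) (s' : State), Runs P s t s' ∧ t ≤ T ∧ ∀ v, s' (e v) = τ v

theorem Realizes.seq {V : Type} {e : V → ℕ} {P Q : Program} {σ τ ρ : V → ℤ} {T T' : ℕ}
    (h : Realizes e P σ T τ) (h' : Realizes e Q τ T' ρ) :
    Realizes e (.seq P Q) σ (T + T') ρ := by
  intro s hs
  obtain ⟨t, s₁, h₁, ht, hs₁⟩ := h s hs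
  obtain ⟨t', s₂, h₂, ht', hs₂⟩ := h' s₁ hs₁
  exact ⟨_, _, .seq h₁ h₂, by omega, hs₂⟩

theorem Realizes.mono {V : Type} {e : V → ℕ} {P : Program} {σ τ : V → ℤ} {T T' : ℕ}
    (h : Realizes e P σ T τ) (hT : T ≤ T') : Realizes e P σ T' τ := by
  intro s hs
  obtain ⟨t, s', h, ht, hs'⟩ := h s hs
  exact ⟨t, s', h, ht.trans hT, hs'⟩

/-- The simultaneous assignment of definable values to the variables in a list. Each value is
computed into its own scratch register before any variable is overwritten. -/
theorem exists_program_assign_list {V : Type} {e : V → ℕ} (he : Function.Injective e)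
    {F : (V → ℤ) → V → ℤ} (hF : ∀ v, Definable fun σ => F σ v) (l : List V) :
    ∀ r, (∀ v, e v < r) → ∃ (P : Program) (c : ℕ), ∀ (σ : V → ℤ) (B : ℕ) (s : State), 1 ≤ B →
      BitBounded σ B → (∀ v, s (e v) = σ v) → ∃ (t : ℕ) (s' : State),
        Runs P s t s' ∧ t ≤ c * B ^ 2 ∧ (∀ v ∈ l, s' (e v) = F σ v) ∧
          ∀ i < r, (∀ v ∈ l, i ≠ e v) → s' i = s i := by
  induction l with
  | nil =>
    intro r hr
    refine ⟨.skip, 1, fun σ B s hB _ _ => ⟨1, s, .skip s, ?_, by simp, by simp⟩⟩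
    nlinarith
  | cons v l ih =>
    intro r hr
    obtain ⟨P, c, hP⟩ := (hF v).exists_program e r hr
    obtain ⟨Q, c', hQ⟩ := ih (r + 1) (fun v => (hr v).trans (by omega))
    obtain ⟨k, hk⟩ := (hF v).exists_bound
    refine ⟨.seq P (.seq Q (.seq (.const (r + 1) 0) (.arith .add (e v) r (r + 1)))),
      c + c' + (k + 2), fun σ B s hB hσ hs => ?_⟩
    obtain ⟨t, s₁, h₁, ht, hv, hi⟩ := hP σ B s hB hσ hs
    obtain ⟨t', s₂, h₂, ht', hv', hi'⟩ := hQ σ B s₁ hB hσ fun v => (hi _ (hr v)).trans (hs v)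
    have hr₂ : s₂ r = F σ v := by
      rw [hi' r (by omega) fun w _ => (hr w).ne', hv]
    refine ⟨_, _, .seq h₁ (.seq h₂ (.seq (.const _ _ _) (.arith _ _ _ _ _))), ?_, ?_, ?_⟩
    · have h0 : bits 0 = 1 := by decide
      simp only [Function.update_self, Function.update_of_ne (Nat.lt_succ_self r).ne, hr₂, h0]
      have := bits_le_of_natAbs_lt (hk σ B hB hσ)
      nlinarith
    · intro w hw
      by_cases hwv : w = v
      · subst hwv
        simp [ArithOp.eval, hr₂]
      · have hne : e w ≠ r + 1 := ((hr w).trans (by omega)).ne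
        rw [Function.update_of_ne (he.ne hwv), Function.update_of_ne hne]
        exact hv' w ((List.mem_cons.1 hw).resolve_left hwv)
    · intro i hir hil
      have hne : i ≠ r + 1 := by omega
      rw [Function.update_of_ne (hil v (by simp)), Function.update_of_ne hne,
        hi' i (by omega) fun w hw => hil w (by simp [hw]), hi i hir]

theorem exists_program_assign {V : Type} [Fintype V] {e : V → ℕ} (he : Function.Injective e)
    {F : (V → ℤ) → V → ℤ} (hF : ∀ v, Definable fun σ => F σ v) :
    ∃ (P : Program) (c : ℕ), ∀ (σ : V → ℤ) (B : ℕ), 1 ≤ B → BitBounded σ B →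
      Realizes e P σ (c * B ^ 2) (F σ) := by
  obtain ⟨P, c, hP⟩ := exists_program_assign_list he hF Finset.univ.toList
    (Finset.univ.sup e + 1) (fun v => Nat.lt_succ_of_le (Finset.le_sup (Finset.mem_univ v)))
  refine ⟨P, c, fun σ B hB hσ s hs => ?_⟩
  obtain ⟨t, s', h, ht, hv, -⟩ := hP σ B s hB hσ hs
  exact ⟨t, s', h, ht, fun v => hv v (by simp)⟩

/-- A while-loop around a simultaneous assignment. The invariant `I k` carries the number `k` of
rounds that are still available. -/
theorem exists_program_loop {V : Type} [Fintype V] {e : V → ℕ} (he : Function.Injective e)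
    {F : (V → ℤ) → V → ℤ} (hF : ∀ v, Definable fun σ => F σ v) (x : V) :
    ∃ (P : Program) (c : ℕ), ∀ (B : ℕ) (I : ℕ → (V → ℤ) → Prop), 1 ≤ B →
      (∀ k σ, I k σ → BitBounded σ B) →
      (∀ k σ, I k σ → 0 < σ x → ∃ k', k = k' + 1 ∧ I k' (F σ)) →
      ∀ k σ, I k σ → ∃ k' τ, I k' τ ∧ τ x ≤ 0 ∧
        Realizes e P σ ((k + 1) * (c * B ^ 2)) τ := by
  obtain ⟨P, c, hP⟩ := exists_program_assign he hF
  refine ⟨.loop (e x) P, c + 2, fun B I hB hI hstep k => ?_⟩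
  induction k with
  | zero =>
    intro σ hσ
    have hx : σ x ≤ 0 := by
      by_contra! hx
      obtain ⟨k', hk', -⟩ := hstep 0 σ hσ hx
      omega
    refine ⟨0, σ, hσ, hx, fun s hs => ⟨_, s, .loop_nonpos (by rwa [hs]), ?_, hs⟩⟩
    rw [hs]
    have := bits_le_of_natAbs_lt (hI _ σ hσ x)
    nlinarith
  | succ k ih =>
    intro σ hσ
    have hb := bits_le_of_natAbs_lt (hI _ σ hσ x)
    by_cases hx : 0 < σ x
    · obtain ⟨k', hk', hσ'⟩ := hstep _ σ hσ hx
      obtain rfl : k = k' := by omega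
      obtain ⟨k', τ, hτ, hτx, hrun⟩ := ih _ hσ'
      refine ⟨k', τ, hτ, hτx, fun s hs => ?_⟩
      obtain ⟨t, s₁, h₁, ht, hs₁⟩ := hP σ B hB (hI _ σ hσ) s hs
      obtain ⟨t', s₂, h₂, ht', hs₂⟩ := hrun s₁ hs₁
      refine ⟨_, s₂, .loop_pos (by rwa [hs]) h₁ h₂, ?_, hs₂⟩
      rw [hs]
      nlinarith
    · refine ⟨k + 1, σ, hσ, not_lt.1 hx, fun s hs =>
        ⟨_, s, .loop_nonpos (by rw [hs]; exact not_lt.1 hx), ?_, hs⟩⟩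
      rw [hs]
      have : 1 ≤ (k + 1 + 1) := by omega
      nlinarith [Nat.zero_le (k * ((c + 2) * B ^ 2))]

/-! ### Closure properties of definable functions -/

section

variable {V : Type} {f g h k : (V → ℤ) → ℤ}

theorem Definable.add (hf : Definable f) (hg : Definable g) : Definable fun σ => f σ + g σ :=
  .arith .add hf hg

theorem Definable.sub (hf : Definable f) (hg : Definable g) : Definable fun σ => f σ - g σ :=
  .arith .sub hf hg

theorem Definable.mul (hf : Definable f) (hg : Definable g) : Definable fun σ => f σ * g σ :=
  .arith .mul hf hg

theorem Definable.div (hf : Definable f) (hg : Definable g) : Definable fun σ => f σ / g σ :=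
  .arith .div hf hg

theorem Definable.emod (hf : Definable f) (hg : Definable g) : Definable fun σ => f σ % g σ := by
  simpa only [Int.emod_def] using hf.sub (hg.mul (hf.div hg))

theorem Definable.sum {ι : Type*} (s : Finset ι) {f : ι → (V → ℤ) → ℤ}
    (hf : ∀ i, Definable (f i)) : Definable fun σ => ∑ i ∈ s, f i σ := by
  classical
  induction s using Finset.induction_on with
  | empty => simpa using Definable.const 0
  | insert i s hi ih => simpa only [Finset.sum_insert hi] using (hf i).add ih

open Classical in
theorem Definable.ite_lt (hf : Definable f) (hg : Definable g) (hh : Definable h)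
    (hk : Definable k) : Definable fun σ => if f σ < g σ then h σ else k σ := by
  simpa only [sub_pos] using (hg.sub hf).ite hh hk

/-- A rational-valued function is definable if it is a quotient of definable functions with a
positive denominator. -/
def RatDefinable (f : (V → ℤ) → ℚ) : Prop :=
  ∃ m n : (V → ℤ) → ℤ, Definable m ∧ Definable n ∧ ∀ σ, 0 < n σ ∧ f σ = m σ / n σ

namespace RatDefinable

variable {u v : (V → ℤ) → ℚ}

theorem intCast (hf : Definable f) : RatDefinable fun σ => (f σ : ℚ) :=
  ⟨f, fun _ => 1, hf, .const 1, fun σ => by simp⟩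

theorem add (hu : RatDefinable u) (hv : RatDefinable v) : RatDefinable fun σ => u σ + v σ := by
  obtain ⟨m, n, hm, hn, h⟩ := hu
  obtain ⟨m', n', hm', hn', h'⟩ := hv
  refine ⟨_, _, (hm.mul hn').add (hn.mul hm'), hn.mul hn', fun σ => ⟨?_, ?_⟩⟩
  · exact mul_pos (h σ).1 (h' σ).1
  · have h1 : (n σ : ℚ) ≠ 0 := by exact_mod_cast (h σ).1.ne'
    have h2 : (n' σ : ℚ) ≠ 0 := by exact_mod_cast (h' σ).1.ne'
    dsimp only
    rw [(h σ).2, (h' σ).2, div_add_div _ _ h1 h2]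
    push_cast
    rfl

theorem mul (hu : RatDefinable u) (hv : RatDefinable v) : RatDefinable fun σ => u σ * v σ := by
  obtain ⟨m, n, hm, hn, h⟩ := hu
  obtain ⟨m', n', hm', hn', h'⟩ := hv
  refine ⟨_, _, hm.mul hm', hn.mul hn', fun σ => ⟨mul_pos (h σ).1 (h' σ).1, ?_⟩⟩
  dsimp only
  rw [(h σ).2, (h' σ).2, div_mul_div_comm]
  push_cast
  rfl

theorem const (c : ℤ) : RatDefinable fun _ : V → ℤ => (c : ℚ) :=
  intCast (.const c)

theorem sub (hu : RatDefinable u) (hv : RatDefinable v) : RatDefinable fun σ => u σ - v σ := by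
  simpa [sub_eq_add_neg] using hu.add ((const (-1)).mul hv)

theorem div (hu : RatDefinable u) (hv : RatDefinable v) : RatDefinable fun σ => u σ / v σ := by
  obtain ⟨m', n', hm', hn', h'⟩ := hv
  -- The inverse of `m / n` is `n * m / m ^ 2`, and `0 / 1` for `m = 0`.
  have hinv : RatDefinable fun σ => (v σ)⁻¹ := by
    refine ⟨_, _, hn'.mul hm', (hm'.mul hm').ite (hm'.mul hm') (.const 1), fun σ => ?_⟩
    by_cases h0 : m' σ = 0
    · simp [h0, (h' σ).2]
    · have hpos : 0 < m' σ * m' σ := mul_self_pos.2 h0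
      have h1 : (n' σ : ℚ) ≠ 0 := by exact_mod_cast (h' σ).1.ne'
      have h2 : (m' σ : ℚ) ≠ 0 := by exact_mod_cast h0
      simp only [hpos, if_true, (h' σ).2, true_and]
      push_cast
      field_simp
  simpa only [div_eq_mul_inv] using hu.mul hinv

theorem sum {ι : Type*} (s : Finset ι) {u : ι → (V → ℤ) → ℚ} (hu : ∀ i ∈ s, RatDefinable (u i)) :
    RatDefinable fun σ => ∑ i ∈ s, u i σ := by
  classical
  induction s using Finset.induction_on with
  | empty => simpa using const 0
  | insert i s hi ih =>
    simpa only [Finset.sum_insert hi] using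
      (hu i (by simp)).add (ih fun j hj => hu j (by simp [hj]))

theorem dotProduct {ι : Type*} [Fintype ι] {u v : (V → ℤ) → ι → ℚ}
    (hu : ∀ i, RatDefinable fun σ => u σ i) (hv : ∀ i, RatDefinable fun σ => v σ i) :
    RatDefinable fun σ => u σ ⬝ᵥ v σ :=
  sum _ fun i _ => (hu i).mul (hv i)

theorem ite_lt (hu : RatDefinable u) (hv : RatDefinable v) (hf : Definable f)
    (hg : Definable g) : Definable fun σ => if u σ < v σ then f σ else g σ := by
  obtain ⟨m, n, hm, hn, h⟩ := hu
  obtain ⟨m', n', hm', hn', h'⟩ := hv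
  have key : ∀ σ, u σ < v σ ↔ m σ * n' σ < m' σ * n σ := by
    intro σ
    rw [(h σ).2, (h' σ).2, div_lt_div_iff₀ (by exact_mod_cast (h σ).1)
      (by exact_mod_cast (h' σ).1)]
    exact_mod_cast Iff.rfl
  simp only [key]
  convert (hm.mul hn').ite_lt (hm'.mul hn) hf hg

theorem round (hu : RatDefinable u) : Definable fun σ => round (u σ) := by
  obtain ⟨m, n, hm, hn, h⟩ := hu
  have key : ∀ σ, _root_.round (u σ) = (2 * m σ + n σ) / (2 * n σ) := by
    intro σ
    have hn0 : (n σ : ℚ) ≠ 0 := by exact_mod_cast (h σ).1.ne'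
    have h2 : u σ + 1 / 2 = ((2 * m σ + n σ : ℤ) : ℚ) / ((2 * n σ).toNat : ℚ) := by
      have h3 : (((2 * n σ).toNat : ℤ) : ℚ) = ((2 * n σ : ℤ) : ℚ) := by
        rw [Int.toNat_of_nonneg (by linarith [(h σ).1])]
      rw [(h σ).2, ← Int.cast_natCast, h3]
      push_cast
      field_simp
    rw [round_eq, h2, Rat.floor_intCast_div_natCast,
      Int.toNat_of_nonneg (by linarith [(h σ).1])]
  simp only [key]
  exact (((Definable.const 2).mul hm).add hn).div ((Definable.const 2).mul hn)

end RatDefinable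

end

/-! ### Gram-Schmidt orthogonalization over the rationals -/

section

variable {ι : Type} [Fintype ι]

/-- The orthogonalization of a sequence of rational vectors, without normalization. Divisions by
zero make the coefficient at a vanishing vector `0`. -/
def gs (b : ℕ → ι → ℚ) : ℕ → ι → ℚ
  | k => b k - ∑ j : Fin k, (b k ⬝ᵥ gs b j / (gs b j ⬝ᵥ gs b j)) • gs b j
decreasing_by exact j.2

/-- The Gram-Schmidt coefficient of `v` at the `j`-th vector of `gs b`. -/
def gsCoeff (b : ℕ → ι → ℚ) (v : ι → ℚ) (j : ℕ) : ℚ :=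
  v ⬝ᵥ gs b j / (gs b j ⬝ᵥ gs b j)

theorem gs_eq (b : ℕ → ι → ℚ) (k : ℕ) :
    gs b k = b k - ∑ j ∈ Finset.range k, gsCoeff b (b k) j • gs b j := by
  rw [gs, ← Fin.sum_univ_eq_sum_range (fun j => gsCoeff b (b k) j • gs b j)]
  rfl

theorem self_eq_gs_add (b : ℕ → ι → ℚ) (k : ℕ) :
    b k = gs b k + ∑ j ∈ Finset.range k, gsCoeff b (b k) j • gs b j := by
  rw [gs_eq b k, sub_add_cancel]

theorem gs_congr {b b' : ℕ → ι → ℚ} {k : ℕ} (h : ∀ j ≤ k, b j = b' j) : gs b k = gs b' k := by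
  induction k using Nat.strong_induction_on with
  | _ k ih =>
    rw [gs_eq, gs_eq, h k le_rfl]
    congr 1
    refine Finset.sum_congr rfl fun j hj => ?_
    have hj' := Finset.mem_range.1 hj
    rw [gsCoeff, gsCoeff, ih j hj' fun i hi => h i (by omega)]

theorem gsCoeff_mul (b : ℕ → ι → ℚ) (v : ι → ℚ) (j : ℕ) :
    gsCoeff b v j * (gs b j ⬝ᵥ gs b j) = v ⬝ᵥ gs b j := by
  by_cases h : gs b j ⬝ᵥ gs b j = 0
  · rw [dotProduct_self_eq_zero.1 h]
    simp
  · rw [gsCoeff, div_mul_cancel₀ _ h]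

theorem gs_orthogonal_of_lt (b : ℕ → ι → ℚ) {k j : ℕ} (h : j < k) : gs b k ⬝ᵥ gs b j = 0 := by
  induction k using Nat.strong_induction_on generalizing j with
  | _ k ih =>
    rw [gs_eq b k, sub_dotProduct, sum_dotProduct,
      Finset.sum_eq_single_of_mem j (Finset.mem_range.2 h), smul_dotProduct, smul_eq_mul,
      gsCoeff_mul, sub_self]
    intro i hi hij
    have hi' := Finset.mem_range.1 hi
    rw [smul_dotProduct]
    rcases lt_or_gt_of_ne hij with hlt | hlt
    · rw [dotProduct_comm, ih j h hlt, smul_zero]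
    · rw [ih i hi' hlt, smul_zero]

theorem gs_orthogonal (b : ℕ → ι → ℚ) {k j : ℕ} (h : j ≠ k) : gs b k ⬝ᵥ gs b j = 0 := by
  rcases lt_or_gt_of_ne h with h | h
  · exact gs_orthogonal_of_lt b h
  · rw [dotProduct_comm, gs_orthogonal_of_lt b h]

/-- An element of the span of the first `j + 1` vectors is orthogonal to `gs b k` for `k > j`. -/
theorem dotProduct_gs_of_lt (b : ℕ → ι → ℚ) {k j : ℕ} (h : j < k) : b j ⬝ᵥ gs b k = 0 := by
  rw [self_eq_gs_add b j, add_dotProduct, sum_dotProduct, gs_orthogonal b h.ne', zero_add]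
  refine Finset.sum_eq_zero fun i hi => ?_
  have := Finset.mem_range.1 hi
  rw [smul_dotProduct, gs_orthogonal b (by omega), smul_zero]

theorem dotProduct_gs_self (b : ℕ → ι → ℚ) (k : ℕ) : b k ⬝ᵥ gs b k = gs b k ⬝ᵥ gs b k := by
  nth_rw 1 [self_eq_gs_add b k]
  rw [add_dotProduct, sum_dotProduct, add_eq_left]
  refine Finset.sum_eq_zero fun i hi => ?_
  have := Finset.mem_range.1 hi
  rw [smul_dotProduct, gs_orthogonal b (by omega), smul_zero]

theorem dotProduct_sum_gs (b : ℕ → ι → ℚ) (s : Finset ℕ) (x y : ℕ → ℚ) :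
    (∑ i ∈ s, x i • gs b i) ⬝ᵥ (∑ i ∈ s, y i • gs b i) =
      ∑ i ∈ s, x i * y i * (gs b i ⬝ᵥ gs b i) := by
  rw [sum_dotProduct]
  refine Finset.sum_congr rfl fun i hi => ?_
  rw [dotProduct_sum, Finset.sum_eq_single_of_mem i hi]
  · simp only [smul_dotProduct, dotProduct_smul, smul_eq_mul]
    ring
  · intro j _ hj
    simp [gs_orthogonal b hj]

theorem self_dotProduct_self (b : ℕ → ι → ℚ) (k : ℕ) :
    b k ⬝ᵥ b k = gs b k ⬝ᵥ gs b k +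
      ∑ j ∈ Finset.range k, gsCoeff b (b k) j ^ 2 * (gs b j ⬝ᵥ gs b j) := by
  have h : gs b k ⬝ᵥ ∑ j ∈ Finset.range k, gsCoeff b (b k) j • gs b j = 0 := by
    rw [dotProduct_sum]
    refine Finset.sum_eq_zero fun i hi => ?_
    have := Finset.mem_range.1 hi
    rw [dotProduct_smul, gs_orthogonal b (by omega), smul_zero]
  have h' := (dotProduct_comm _ _).trans h
  nth_rw 1 2 [self_eq_gs_add b k]
  rw [add_dotProduct, dotProduct_add, dotProduct_add, h, h', dotProduct_sum_gs]
  simp [pow_two]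

theorem rat_dotProduct_self_nonneg (v : ι → ℚ) : 0 ≤ v ⬝ᵥ v :=
  Finset.sum_nonneg fun i _ => mul_self_nonneg (v i)

theorem gs_dotProduct_self_le (b : ℕ → ι → ℚ) (k : ℕ) : gs b k ⬝ᵥ gs b k ≤ b k ⬝ᵥ b k := by
  rw [self_dotProduct_self b, le_add_iff_nonneg_right]
  exact Finset.sum_nonneg fun j _ => mul_nonneg (sq_nonneg _) (rat_dotProduct_self_nonneg _)

/-- Subtracting combinations of earlier vectors does not change the orthogonalization. -/
theorem gs_eq_of_sub_mem {b b' : ℕ → ι → ℚ} (c : ℕ → ℕ → ℚ)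
    (h : ∀ k, b' k = b k - ∑ j ∈ Finset.range k, c k j • b j) (k : ℕ) : gs b' k = gs b k := by
  induction k using Nat.strong_induction_on with
  | _ k ih =>
    -- The vectors `b j` with `j < k` are combinations of the `gs b i` with `i < k`, hence fixed
    -- by the projection onto their span.
    have hproj : ∀ j ∈ Finset.range k,
        ∑ i ∈ Finset.range k, gsCoeff b (b j) i • gs b i = b j := by
      intro j hj
      have hj' := Finset.mem_range.1 hj
      have hsub : Finset.range (j + 1) ⊆ Finset.range k :=
        Finset.range_subset_range.2 hj'
      rw [← Finset.sum_subset hsub, Finset.sum_range_succ, add_comm]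
      · have hself : gsCoeff b (b j) j • gs b j = gs b j := by
          by_cases h0 : gs b j ⬝ᵥ gs b j = 0
          · rw [dotProduct_self_eq_zero.1 h0, smul_zero]
          · rw [gsCoeff, dotProduct_gs_self, div_self h0, one_smul]
        rw [hself, ← self_eq_gs_add]
      · intro i _ hi
        rw [gsCoeff, dotProduct_gs_of_lt b (by simpa using hi), zero_div, zero_smul]
    have hlin : ∀ i, gsCoeff b (b' k) i =
        gsCoeff b (b k) i - ∑ j ∈ Finset.range k, c k j * gsCoeff b (b j) i := by
      intro i
      rw [h k]
      simp only [gsCoeff, sub_dotProduct, sum_dotProduct, smul_dotProduct, smul_eq_mul, sub_div,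
        Finset.sum_div, mul_div_assoc]
    have hcoeff : ∀ i ∈ Finset.range k, gsCoeff b' (b' k) i • gs b' i =
        gsCoeff b (b' k) i • gs b i := by
      intro i hi
      rw [gsCoeff, gsCoeff, ih i (Finset.mem_range.1 hi)]
    rw [gs_eq, gs_eq, Finset.sum_congr rfl hcoeff]
    simp only [hlin, sub_smul, Finset.sum_sub_distrib, Finset.sum_smul]
    rw [Finset.sum_comm]
    simp only [mul_smul, ← Finset.smul_sum]
    rw [Finset.sum_congr rfl fun j hj => congrArg (c k j • ·) (hproj j hj), h k]
    abel

/-- The Gram determinant of the first `k` vectors, as a product of squared lengths. -/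
def gramProd (b : ℕ → ι → ℚ) (k : ℕ) : ℚ :=
  ∏ i ∈ Finset.range k, gs b i ⬝ᵥ gs b i

/-- The Gram matrix is `U D Uᵀ` with the unitriangular matrix `U` of the Gram-Schmidt coefficients
and the diagonal matrix `D` of the squared lengths. -/
theorem det_gram (b : ℕ → ι → ℚ) (k : ℕ) :
    (Matrix.of fun i j : Fin k => b i ⬝ᵥ b j).det = gramProd b k := by
  let U : Matrix (Fin k) (Fin k) ℚ := Matrix.of fun i j =>
    if j < i then gsCoeff b (b i) j else if j = i then 1 else 0
  have hU : ∀ i : Fin k, b i = ∑ l : Fin k, U i l • gs b l := by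
    intro i
    have hsum : ∑ l : Fin k, U i l • gs b l = ∑ l ∈ Finset.range k,
        (if l < i then gsCoeff b (b i) l else if l = i then 1 else 0) • gs b l := by
      rw [← Fin.sum_univ_eq_sum_range (fun l =>
        (if l < (i : ℕ) then gsCoeff b (b i) l else if l = i then 1 else 0) • gs b l)]
      refine Finset.sum_congr rfl fun l _ => ?_
      simp [U, Fin.ext_iff]
    have hsub : Finset.range (i + 1) ⊆ Finset.range k := Finset.range_subset_range.2 i.2
    rw [hsum, ← Finset.sum_subset hsub, Finset.sum_range_succ]
    · nth_rw 1 [self_eq_gs_add b i]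
      rw [add_comm]
      congr 1
      · refine Finset.sum_congr rfl fun l hl => ?_
        rw [if_pos (Finset.mem_range.1 hl)]
      · simp
    · intro l _ hl
      have : (i : ℕ) < l := by simpa using hl
      rw [if_neg (by omega), if_neg (by omega), zero_smul]
  have hG : (Matrix.of fun i j : Fin k => b i ⬝ᵥ b j) =
      U * Matrix.diagonal (fun l : Fin k => gs b l ⬝ᵥ gs b l) * U.transpose := by
    ext i j
    rw [Matrix.of_apply, hU i, hU j, Matrix.mul_apply]
    simp only [Matrix.mul_diagonal, Matrix.transpose_apply, sum_dotProduct, dotProduct_sum,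
      smul_dotProduct, dotProduct_smul, smul_eq_mul]
    refine Finset.sum_congr rfl fun l _ => ?_
    rw [Finset.sum_eq_single_of_mem l (Finset.mem_univ l)]
    · ring
    · intro m _ hm
      rw [gs_orthogonal b (by simpa [Fin.ext_iff] using hm.symm), mul_zero]
  have hdet : U.det = 1 := by
    rw [Matrix.det_of_isLowerTriangular]
    · simp [U]
    · intro i j hij
      have hij' : i < j := by simpa using hij
      simp [U, hij'.not_gt, hij'.ne']
  rw [hG, Matrix.det_mul, Matrix.det_mul, Matrix.det_transpose, hdet, Matrix.det_diagonal,
    gramProd, Fin.prod_univ_eq_prod_range (fun l => gs b l ⬝ᵥ gs b l)]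
  ring

theorem gramProd_succ (b : ℕ → ι → ℚ) (k : ℕ) :
    gramProd b (k + 1) = gramProd b k * (gs b k ⬝ᵥ gs b k) :=
  Finset.prod_range_succ _ _

theorem gramProd_congr {b b' : ℕ → ι → ℚ} {k : ℕ} (h : ∀ j < k, b j = b' j) :
    gramProd b k = gramProd b' k := by
  refine Finset.prod_congr rfl fun i hi => ?_
  have := Finset.mem_range.1 hi
  rw [gs_congr fun j hj => h j (by omega)]

/-- A Gram determinant does not depend on the order of the vectors. -/
theorem gramProd_swap (b : ℕ → ι → ℚ) {i k : ℕ} (h : i + 1 ≠ k) :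
    gramProd (b ∘ Equiv.swap i (i + 1)) k = gramProd b k := by
  rcases lt_or_gt_of_ne h with h | h
  · let e : Equiv.Perm (Fin k) := Equiv.swap ⟨i, by omega⟩ ⟨i + 1, h⟩
    have he : ∀ j : Fin k, ((e j : Fin k) : ℕ) = Equiv.swap i (i + 1) (j : ℕ) := by
      intro j
      simp only [e, Equiv.swap_apply_def, Fin.ext_iff]
      split_ifs <;> rfl
    rw [← det_gram, ← det_gram, ← Matrix.det_submatrix_equiv_self e]
    congr 1
    ext x y
    simp [he]
  · refine gramProd_congr fun j hj => ?_
    rw [Function.comp_apply, Equiv.swap_apply_of_ne_of_ne (by omega) (by omega)]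

/-- Swapping `b i` and `b (i + 1)` replaces `gs b i` by the projection of `b (i + 1)`. -/
theorem gs_swap (b : ℕ → ι → ℚ) (i : ℕ) :
    gs (b ∘ Equiv.swap i (i + 1)) i = gs b (i + 1) + gsCoeff b (b (i + 1)) i • gs b i := by
  have hpre : ∀ j < i, gs (b ∘ Equiv.swap i (i + 1)) j = gs b j := by
    intro j hj
    refine gs_congr fun l hl => ?_
    rw [Function.comp_apply, Equiv.swap_apply_of_ne_of_ne (by omega) (by omega)]
  rw [gs_eq, gs_eq b (i + 1), Finset.sum_range_succ, Function.comp_apply, Equiv.swap_apply_left]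
  have : ∀ j ∈ Finset.range i, gsCoeff (b ∘ Equiv.swap i (i + 1)) (b (i + 1)) j •
      gs (b ∘ Equiv.swap i (i + 1)) j = gsCoeff b (b (i + 1)) j • gs b j := by
    intro j hj
    rw [gsCoeff, gsCoeff, hpre j (Finset.mem_range.1 hj)]
  rw [Finset.sum_congr rfl this]
  abel

theorem gs_swap_dotProduct_self (b : ℕ → ι → ℚ) (i : ℕ) :
    gs (b ∘ Equiv.swap i (i + 1)) i ⬝ᵥ gs (b ∘ Equiv.swap i (i + 1)) i =
      gs b (i + 1) ⬝ᵥ gs b (i + 1) +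
        gsCoeff b (b (i + 1)) i ^ 2 * (gs b i ⬝ᵥ gs b i) := by
  rw [gs_swap, add_dotProduct, dotProduct_add, dotProduct_add, smul_dotProduct, smul_dotProduct,
    dotProduct_smul, dotProduct_smul, gs_orthogonal b (Nat.lt_succ_self i).ne,
    gs_orthogonal b (Nat.lt_succ_self i).ne']
  simp only [smul_eq_mul]
  ring

end

/-! ### Lattice basis reduction -/

section

variable {ι : Type} [Fintype ι]

/-- An integer vector as a rational vector. -/
def ratVec (v : ι → ℤ) : ι → ℚ := fun l => v l

theorem gsCoeff_sub (b : ℕ → ι → ℚ) (v w : ι → ℚ) (j : ℕ) :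
    gsCoeff b (v - w) j = gsCoeff b v j - gsCoeff b w j := by
  rw [gsCoeff, sub_dotProduct, sub_div, gsCoeff, gsCoeff]

theorem gsCoeff_smul (b : ℕ → ι → ℚ) (c : ℚ) (v : ι → ℚ) (j : ℕ) :
    gsCoeff b (c • v) j = c * gsCoeff b v j := by
  rw [gsCoeff, smul_dotProduct, smul_eq_mul, mul_div_assoc, gsCoeff]

/-- Makes the Gram-Schmidt coefficients of `v` at the first `j` vectors small by subtracting
integer multiples of `b (j - 1)`, …, `b 0`, in this order. -/
def nearest (b : ℕ → ι → ℤ) : ℕ → (ι → ℤ) → ι → ℤ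
  | 0, v => v
  | j + 1, v =>
    nearest b j fun l => v l - round (gsCoeff (fun k => ratVec (b k)) (ratVec v) j) * b j l

theorem exists_nearest_eq (b : ℕ → ι → ℤ) (j : ℕ) (v : ι → ℤ) :
    ∃ c : ℕ → ℤ, nearest b j v = v - ∑ i ∈ Finset.range j, c i • b i := by
  induction j generalizing v with
  | zero => exact ⟨0, by simp [nearest]⟩
  | succ j ih =>
    set r := round (gsCoeff (fun k => ratVec (b k)) (ratVec v) j) with hr
    obtain ⟨c, hc⟩ := ih fun l => v l - r * b j l
    refine ⟨Function.update c j r, ?_⟩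
    rw [nearest, ← hr, hc, Finset.sum_range_succ, Function.update_self]
    have : ∀ i ∈ Finset.range j, Function.update c j r i • b i = c i • b i := by
      intro i hi
      rw [Function.update_of_ne (Finset.mem_range.1 hi).ne]
    rw [Finset.sum_congr rfl this]
    ext l
    simp only [Pi.sub_apply, Pi.add_apply, Pi.smul_apply, smul_eq_mul]
    ring

omit [Fintype ι] in
theorem ratVec_sub_sum (v : ι → ℤ) (s : Finset ℕ) (c : ℕ → ℤ) (b : ℕ → ι → ℤ) :
    ratVec (v - ∑ i ∈ s, c i • b i) = ratVec v - ∑ i ∈ s, (c i : ℚ) • ratVec (b i) := by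
  ext l
  simp [ratVec]

theorem abs_gsCoeff_nearest_le (b : ℕ → ι → ℤ) {i j : ℕ} (h : i < j) (v : ι → ℤ) :
    |gsCoeff (fun k => ratVec (b k)) (ratVec (nearest b j v)) i| ≤ 1 / 2 := by
  induction j generalizing v with
  | zero => omega
  | succ j ih =>
    rw [nearest]
    set r := round (gsCoeff (fun k => ratVec (b k)) (ratVec v) j) with hr
    rcases Nat.lt_succ_iff_lt_or_eq.1 h with h | rfl
    · exact ih h _
    · obtain ⟨c, hc⟩ := exists_nearest_eq b i fun l => v l - r * b i l
      have hv : ratVec (fun l => v l - r * b i l) = ratVec v - (r : ℚ) • ratVec (b i) := by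
        ext l
        simp [ratVec]
      have hzero : gsCoeff (fun k => ratVec (b k))
          (∑ j ∈ Finset.range i, (c j : ℚ) • ratVec (b j)) i = 0 := by
        rw [gsCoeff, sum_dotProduct, Finset.sum_eq_zero, zero_div]
        intro j hj
        rw [smul_dotProduct,
          dotProduct_gs_of_lt (fun k => ratVec (b k)) (Finset.mem_range.1 hj), smul_zero]
      rw [hc, ratVec_sub_sum, gsCoeff_sub, hzero, sub_zero, hv, gsCoeff_sub, gsCoeff_smul]
      by_cases h0 : gs (fun k => ratVec (b k)) i ⬝ᵥ gs (fun k => ratVec (b k)) i = 0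
      · simp [gsCoeff, h0]
      · have h1 : gsCoeff (fun k => ratVec (b k)) (ratVec (b i)) i = 1 := by
          rw [gsCoeff, dotProduct_gs_self (fun k => ratVec (b k)), div_self h0]
        rw [h1, mul_one, hr]
        exact abs_sub_round _

/-- Size reduction of all vectors. -/
def sizeReduce (b : ℕ → ι → ℤ) (k : ℕ) : ι → ℤ :=
  nearest b k (b k)

theorem exists_sizeReduce_eq (b : ℕ → ι → ℤ) :
    ∃ c : ℕ → ℕ → ℤ, ∀ k, sizeReduce b k = b k - ∑ j ∈ Finset.range k, c k j • b j := by
  choose c hc using fun k => exists_nearest_eq b k (b k)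
  exact ⟨c, hc⟩

theorem gs_sizeReduce (b : ℕ → ι → ℤ) :
    gs (fun k => ratVec (sizeReduce b k)) = gs fun k => ratVec (b k) := by
  obtain ⟨c, hc⟩ := exists_sizeReduce_eq b
  ext1 k
  exact gs_eq_of_sub_mem (fun k j => (c k j : ℚ)) (fun k => by rw [hc, ratVec_sub_sum]) k

theorem sq_gsCoeff_sizeReduce_le (b : ℕ → ι → ℤ) {j k : ℕ} (h : j < k) :
    gsCoeff (fun k => ratVec (sizeReduce b k)) (ratVec (sizeReduce b k)) j ^ 2 ≤ 1 / 4 := by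
  have h1 : gsCoeff (fun k => ratVec (sizeReduce b k)) (ratVec (sizeReduce b k)) j =
      gsCoeff (fun k => ratVec (b k)) (ratVec (sizeReduce b k)) j := by
    rw [gsCoeff, gsCoeff, gs_sizeReduce]
  have h2 := abs_gsCoeff_nearest_le b h (b k)
  rw [h1, ← sq_abs]
  change |gsCoeff _ (ratVec (nearest b k (b k))) j| ^ 2 ≤ _
  nlinarith [abs_nonneg (gsCoeff (fun k => ratVec (b k)) (ratVec (nearest b k (b k))) j)]

/-- A size-reduced vector is bounded in terms of the orthogonalized vectors alone. This keeps the
entries small: each round of the reduction multiplies the lengths by at most a constant. -/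
theorem sizeReduce_dotProduct_self_le (b : ℕ → ι → ℤ) (k : ℕ) :
    ratVec (sizeReduce b k) ⬝ᵥ ratVec (sizeReduce b k) ≤
      ∑ j ∈ Finset.range (k + 1),
        gs (fun k => ratVec (b k)) j ⬝ᵥ gs (fun k => ratVec (b k)) j := by
  rw [self_dotProduct_self (fun k => ratVec (sizeReduce b k)), Finset.sum_range_succ, add_comm,
    gs_sizeReduce]
  refine add_le_add_left (Finset.sum_le_sum fun j hj => ?_) _
  have h := sq_gsCoeff_sizeReduce_le b (Finset.mem_range.1 hj)
  have h0 := rat_dotProduct_self_nonneg (gs (fun k => ratVec (b k)) j)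
  nlinarith

theorem gramProd_sizeReduce (b : ℕ → ι → ℤ) (k : ℕ) :
    gramProd (fun k => ratVec (sizeReduce b k)) k = gramProd (fun k => ratVec (b k)) k := by
  rw [gramProd, gramProd, gs_sizeReduce]

theorem span_sizeReduce (b : ℕ → ι → ℤ) (n : ℕ) :
    Submodule.span ℤ (sizeReduce b '' Set.Iio n) = Submodule.span ℤ (b '' Set.Iio n) := by
  obtain ⟨c, hc⟩ := exists_sizeReduce_eq b
  refine le_antisymm (Submodule.span_le.2 ?_) (Submodule.span_le.2 ?_)
  · rintro _ ⟨k, hk, rfl⟩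
    rw [hc]
    refine Submodule.sub_mem _ (Submodule.subset_span ⟨k, hk, rfl⟩)
      (Submodule.sum_mem _ fun j hj => Submodule.smul_mem _ _ (Submodule.subset_span ⟨j, ?_, rfl⟩))
    exact (Finset.mem_range.1 hj).trans hk
  · rintro _ ⟨k, hk, rfl⟩
    induction k using Nat.strong_induction_on with
    | _ k ih =>
      have h : b k = sizeReduce b k + ∑ j ∈ Finset.range k, c k j • b j := by
        rw [hc, sub_add_cancel]
      rw [h]
      refine Submodule.add_mem _ (Submodule.subset_span ⟨k, hk, rfl⟩)
        (Submodule.sum_mem _ fun j hj => Submodule.smul_mem _ _ ?_)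
      have hj' := Finset.mem_range.1 hj
      exact ih j hj' (hj'.trans hk)

/-- The vectors `b i` and `b (i + 1)` violate Siegel's condition. -/
def Unreduced (b : ℕ → ι → ℤ) (i : ℕ) : Prop :=
  2 * (gs (fun k => ratVec (b k)) (i + 1) ⬝ᵥ gs (fun k => ratVec (b k)) (i + 1)) <
    gs (fun k => ratVec (b k)) i ⬝ᵥ gs (fun k => ratVec (b k)) i

instance (b : ℕ → ι → ℤ) (i : ℕ) : Decidable (Unreduced b i) :=
  inferInstanceAs (Decidable (_ < _))

/-- One round of the reduction: size reduction, and then a swap at the last place below the second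
argument where Siegel's condition is violated, if there is one. -/
def reduceStep (b : ℕ → ι → ℤ) : ℕ → ℕ → ι → ℤ
  | 0 => sizeReduce b
  | i + 1 => if Unreduced b i then sizeReduce b ∘ Equiv.swap i (i + 1) else reduceStep b i

/-- `1` if Siegel's condition is violated at some place below the second argument, otherwise
`0`. -/
def unreducedFlag (b : ℕ → ι → ℤ) : ℕ → ℤ
  | 0 => 0
  | i + 1 => if Unreduced b i then 1 else unreducedFlag b i

theorem reduceStep_cases (b : ℕ → ι → ℤ) (m : ℕ) :
    (unreducedFlag b m = 0 ∧ reduceStep b m = sizeReduce b ∧ ∀ i < m, ¬ Unreduced b i) ∨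
      unreducedFlag b m = 1 ∧
        ∃ i < m, Unreduced b i ∧ reduceStep b m = sizeReduce b ∘ Equiv.swap i (i + 1) := by
  induction m with
  | zero => exact .inl ⟨rfl, rfl, by simp⟩
  | succ m ih =>
    by_cases h : Unreduced b m
    · exact .inr ⟨by simp [unreducedFlag, h], m, by simp, h, by simp [reduceStep, h]⟩
    · simp only [unreducedFlag, reduceStep, h, if_false]
      rcases ih with ⟨h1, h2, h3⟩ | ⟨h1, i, hi, h2⟩
      · refine .inl ⟨h1, h2, fun i hi => ?_⟩
        rcases Nat.lt_succ_iff_lt_or_eq.1 hi with hi | rfl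
        · exact h3 i hi
        · exact h
      · exact .inr ⟨h1, i, by omega, h2⟩

theorem image_swap_Iio {i n : ℕ} (h : i + 1 < n) :
    Equiv.swap i (i + 1) '' Set.Iio n = Set.Iio n := by
  refine Set.Subset.antisymm ?_ fun k hk => ⟨Equiv.swap i (i + 1) k, ?_, by simp⟩
  · rintro _ ⟨k, hk, rfl⟩
    rw [Set.mem_Iio] at hk ⊢
    rw [Equiv.swap_apply_def]
    split_ifs <;> omega
  · rw [Set.mem_Iio] at hk ⊢
    rw [Equiv.swap_apply_def]
    split_ifs <;> omega

theorem span_reduceStep (b : ℕ → ι → ℤ) (m : ℕ) :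
    Submodule.span ℤ (reduceStep b m '' Set.Iio (m + 1)) =
      Submodule.span ℤ (b '' Set.Iio (m + 1)) := by
  rw [← span_sizeReduce b]
  rcases reduceStep_cases b m with ⟨-, h, -⟩ | ⟨-, i, hi, -, h⟩
  · rw [h]
  · rw [h, Set.image_comp, image_swap_Iio (by omega)]

theorem reduceStep_dotProduct_self_le (b : ℕ → ι → ℤ) {m : ℕ} {M : ℚ}
    (hM : ∀ k < m + 1, ratVec (b k) ⬝ᵥ ratVec (b k) ≤ M) {k : ℕ} (hk : k < m + 1) :
    ratVec (reduceStep b m k) ⬝ᵥ ratVec (reduceStep b m k) ≤ (m + 1) * M := by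
  have hM0 : 0 ≤ M := (rat_dotProduct_self_nonneg _).trans (hM k hk)
  have key : ∀ k < m + 1,
      ratVec (sizeReduce b k) ⬝ᵥ ratVec (sizeReduce b k) ≤ (m + 1) * M := by
    intro k hk
    refine (sizeReduce_dotProduct_self_le b k).trans ?_
    refine (Finset.sum_le_card_nsmul _ _ M fun j hj => ?_).trans ?_
    · have := Finset.mem_range.1 hj
      exact (gs_dotProduct_self_le (fun k => ratVec (b k)) j).trans (hM j (by omega))
    · rw [Finset.card_range, nsmul_eq_mul]
      have : ((k + 1 : ℕ) : ℚ) ≤ m + 1 := by exact_mod_cast hk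
      exact mul_le_mul_of_nonneg_right this hM0
  rcases reduceStep_cases b m with ⟨-, h, -⟩ | ⟨-, i, hi, -, h⟩
  · rw [h]
    exact key k hk
  · rw [h]
    refine key _ ?_
    have : Equiv.swap i (i + 1) k ∈ Equiv.swap i (i + 1) '' Set.Iio (m + 1) := ⟨k, hk, rfl⟩
    rwa [image_swap_Iio (by omega)] at this

theorem gs_pos_of_gramProd_ne_zero {b : ℕ → ι → ℚ} {n : ℕ} (h : gramProd b n ≠ 0) {i : ℕ}
    (hi : i < n) : 0 < gs b i ⬝ᵥ gs b i :=
  (rat_dotProduct_self_nonneg _).lt_of_ne'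
    (Finset.prod_ne_zero_iff.1 h i (Finset.mem_range.2 hi))

/-- The Gram determinants of integer vectors are integers, so they are at least `1`. -/
theorem one_le_gramProd {b : ℕ → ι → ℤ} {n : ℕ} (h : gramProd (fun k => ratVec (b k)) n ≠ 0)
    {k : ℕ} (hk : k ≤ n) : 1 ≤ gramProd (fun k => ratVec (b k)) k := by
  have hpos : 0 < gramProd (fun k => ratVec (b k)) k :=
    Finset.prod_pos fun i hi =>
      gs_pos_of_gramProd_ne_zero h ((Finset.mem_range.1 hi).trans_le hk)
  have hint : gramProd (fun k => ratVec (b k)) k =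
      ((Matrix.of fun i j : Fin k => b i ⬝ᵥ b j).det : ℤ) := by
    rw [← det_gram, Int.cast_det]
    congr 1
    ext i j
    simp [ratVec, dotProduct]
  rw [hint] at hpos ⊢
  exact_mod_cast hpos

/-- The potential of the reduction, which drops by the factor `3 / 4` with each swap. -/
def potential (b : ℕ → ι → ℤ) (n : ℕ) : ℚ :=
  ∏ k ∈ Finset.range n, gramProd (fun k => ratVec (b k)) k

theorem one_le_potential {b : ℕ → ι → ℤ} {n : ℕ}
    (h : gramProd (fun k => ratVec (b k)) n ≠ 0) : 1 ≤ potential b n :=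
  Finset.one_le_prod fun _ hk => one_le_gramProd h (Finset.mem_range.1 hk).le

/-- The initial value of the potential is polynomial in a bound for the squared lengths. -/
theorem potential_le {b : ℕ → ι → ℤ} {n : ℕ} {M : ℚ} (hM1 : 1 ≤ M)
    (hM : ∀ k < n, ratVec (b k) ⬝ᵥ ratVec (b k) ≤ M) : potential b n ≤ M ^ (n * n) := by
  have hgs : ∀ i < n, gs (fun k => ratVec (b k)) i ⬝ᵥ gs (fun k => ratVec (b k)) i ≤ M :=
    fun i hi => (gs_dotProduct_self_le _ i).trans (hM i hi)
  have hgram : ∀ k ∈ Finset.range n, gramProd (fun k => ratVec (b k)) k ≤ M ^ n := by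
    intro k hk
    have hk' := Finset.mem_range.1 hk
    calc gramProd (fun k => ratVec (b k)) k ≤ ∏ i ∈ Finset.range k, M :=
          Finset.prod_le_prod (fun i _ => rat_dotProduct_self_nonneg _) fun i hi =>
            hgs i ((Finset.mem_range.1 hi).trans hk')
      _ = M ^ k := by simp
      _ ≤ M ^ n := pow_le_pow_right₀ hM1 hk'.le
  calc potential b n ≤ ∏ k ∈ Finset.range n, M ^ n :=
        Finset.prod_le_prod
          (fun k _ => Finset.prod_nonneg fun i _ => rat_dotProduct_self_nonneg _) hgram
    _ = M ^ (n * n) := by simp [pow_mul]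

theorem potential_swap_le {b : ℕ → ι → ℤ} {m i : ℕ} (hi : i < m) (hu : Unreduced b i) :
    potential (sizeReduce b ∘ Equiv.swap i (i + 1)) (m + 1) ≤ 3 / 4 * potential b (m + 1) := by
  have hmem : i + 1 ∈ Finset.range (m + 1) := by simpa using hi
  have hcomp : (fun k => ratVec ((sizeReduce b ∘ Equiv.swap i (i + 1)) k)) =
      (fun k => ratVec (sizeReduce b k)) ∘ Equiv.swap i (i + 1) := rfl
  rw [potential, potential, ← Finset.mul_prod_erase _ _ hmem, ← Finset.mul_prod_erase _ _ hmem,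
    hcomp, ← mul_assoc]
  have herase : ∀ k ∈ (Finset.range (m + 1)).erase (i + 1),
      gramProd ((fun k => ratVec (sizeReduce b k)) ∘ Equiv.swap i (i + 1)) k =
        gramProd (fun k => ratVec (b k)) k := by
    intro k hk
    rw [gramProd_swap _ (Finset.ne_of_mem_erase hk).symm, gramProd_sizeReduce]
  rw [Finset.prod_congr rfl herase]
  refine mul_le_mul_of_nonneg_right ?_
    (Finset.prod_nonneg fun k _ => Finset.prod_nonneg fun i _ => rat_dotProduct_self_nonneg _)
  have hpos : 0 ≤ gramProd (fun k => ratVec (b k)) i :=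
    Finset.prod_nonneg fun i _ => rat_dotProduct_self_nonneg _
  rw [gramProd_succ, gramProd_succ, gramProd_swap _ (by omega), gramProd_sizeReduce,
    gs_swap_dotProduct_self, gs_sizeReduce, mul_left_comm]
  refine mul_le_mul_of_nonneg_left ?_ hpos
  have h1 := sq_gsCoeff_sizeReduce_le b (Nat.lt_succ_self i)
  have h2 := rat_dotProduct_self_nonneg (gs (fun k => ratVec (b k)) i)
  have h3 := mul_le_mul_of_nonneg_right h1 h2
  rw [Unreduced] at hu
  linarith

/-- A size-reduced basis with Siegel's condition is, up to a constant factor, as short as the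
last orthogonalized vector. -/
theorem sum_sizeReduce_le {b : ℕ → ι → ℤ} {m : ℕ} (h : ∀ i < m, ¬ Unreduced b i) :
    ∑ k ∈ Finset.range (m + 1), ratVec (sizeReduce b k) ⬝ᵥ ratVec (sizeReduce b k) ≤
      (m + 1) ^ 2 * 2 ^ m *
        (gs (fun k => ratVec (b k)) m ⬝ᵥ gs (fun k => ratVec (b k)) m) := by
  set A := gs (fun k => ratVec (b k)) m ⬝ᵥ gs (fun k => ratVec (b k)) m with hA
  have hA0 : 0 ≤ A := rat_dotProduct_self_nonneg _
  have hgs : ∀ j ≤ m, gs (fun k => ratVec (b k)) (m - j) ⬝ᵥ gs (fun k => ratVec (b k)) (m - j) ≤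
      2 ^ j * A := by
    intro j hj
    induction j with
    | zero => simp [hA]
    | succ j ih =>
      have h1 := h (m - (j + 1)) (by omega)
      rw [Unreduced, not_lt, show m - (j + 1) + 1 = m - j by omega] at h1
      rw [pow_succ]
      linarith [ih (by omega)]
  have hgs' : ∀ j ≤ m, gs (fun k => ratVec (b k)) j ⬝ᵥ gs (fun k => ratVec (b k)) j ≤
      2 ^ m * A := by
    intro j hj
    have h1 := hgs (m - j) (by omega)
    rw [show m - (m - j) = j by omega] at h1
    exact h1.trans (mul_le_mul_of_nonneg_right
      (pow_le_pow_right₀ (by norm_num) (Nat.sub_le _ _)) hA0)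
  have hrow : ∀ k ∈ Finset.range (m + 1),
      ratVec (sizeReduce b k) ⬝ᵥ ratVec (sizeReduce b k) ≤ (m + 1) * (2 ^ m * A) := by
    intro k hk
    have hk' := Finset.mem_range.1 hk
    refine (sizeReduce_dotProduct_self_le b k).trans ?_
    refine (Finset.sum_le_card_nsmul _ _ (2 ^ m * A) fun j hj => hgs' j ?_).trans ?_
    · have := Finset.mem_range.1 hj
      omega
    · rw [Finset.card_range, nsmul_eq_mul]
      have : ((k + 1 : ℕ) : ℚ) ≤ m + 1 := by exact_mod_cast hk'
      exact mul_le_mul_of_nonneg_right this (by positivity)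
  refine (Finset.sum_le_card_nsmul _ _ _ hrow).trans_eq ?_
  rw [Finset.card_range, nsmul_eq_mul]
  push_cast
  ring

/-! ### The reduction step as a program -/

section Definable

variable {V : Type} {β : (V → ℤ) → ℕ → ι → ℤ}

theorem ratDefinable_gs (hβ : ∀ k l, Definable fun σ => β σ k l) (k : ℕ) (l : ι) :
    RatDefinable fun σ => gs (fun k => ratVec (β σ k)) k l := by
  induction k using Nat.strong_induction_on generalizing l with
  | _ k ih =>
    simp only [gs_eq _ k, Pi.sub_apply, Finset.sum_apply, Pi.smul_apply, smul_eq_mul]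
    refine (RatDefinable.intCast (hβ k l)).sub (RatDefinable.sum _ fun j hj => ?_)
    have hj' := ih j (Finset.mem_range.1 hj)
    exact ((RatDefinable.dotProduct (fun l => RatDefinable.intCast (hβ k l)) hj').div
      (RatDefinable.dotProduct hj' hj')).mul (hj' l)

theorem definable_nearest (hβ : ∀ k l, Definable fun σ => β σ k l) (j : ℕ)
    {v : (V → ℤ) → ι → ℤ} (hv : ∀ l, Definable fun σ => v σ l) (l : ι) :
    Definable fun σ => nearest (β σ) j (v σ) l := by
  induction j generalizing v l with
  | zero => exact hv l
  | succ j ih =>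
    refine ih (fun l => (hv l).sub (Definable.mul (RatDefinable.round ?_) (hβ j l))) l
    have hj := ratDefinable_gs hβ j
    exact (RatDefinable.dotProduct (fun l => RatDefinable.intCast (hv l)) hj).div
      (RatDefinable.dotProduct hj hj)

theorem Definable.ite_unreduced (hβ : ∀ k l, Definable fun σ => β σ k l) (i : ℕ)
    {f g : (V → ℤ) → ℤ} (hf : Definable f) (hg : Definable g) :
    Definable fun σ => if Unreduced (β σ) i then f σ else g σ :=
  RatDefinable.ite_lt
    ((RatDefinable.const 2).mul
      (RatDefinable.dotProduct (ratDefinable_gs hβ (i + 1)) (ratDefinable_gs hβ (i + 1))))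
    (RatDefinable.dotProduct (ratDefinable_gs hβ i) (ratDefinable_gs hβ i)) hf hg

theorem definable_reduceStep (hβ : ∀ k l, Definable fun σ => β σ k l) (m k : ℕ) (l : ι) :
    Definable fun σ => reduceStep (β σ) m k l := by
  induction m with
  | zero => exact definable_nearest hβ k (hβ k) l
  | succ i ih =>
    have h := fun k => definable_nearest hβ k (hβ k) l
    convert Definable.ite_unreduced hβ i (h (Equiv.swap i (i + 1) k)) ih using 2 with σ
    rw [reduceStep]
    split_ifs <;> rfl

theorem definable_unreducedFlag (hβ : ∀ k l, Definable fun σ => β σ k l) (m : ℕ) :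
    Definable fun σ => unreducedFlag (β σ) m := by
  induction m with
  | zero => exact .const 0
  | succ i ih => exact Definable.ite_unreduced hβ i (.const 1) ih

end Definable

end

/-! ### Bases of the lattice and its height -/

section

variable {d q : ℕ} {a : Fin (d + 1) → ZMod q}

theorem mem_lattice {x : Fin (d - 1) → ℤ} :
    x ∈ lattice a ↔ ∑ i : Fin (d - 1), (x i : ZMod q) * a (Fin.castLE (by omega) i) = 0 :=
  Iff.rfl

theorem euclideanNorm_sq {n : ℕ} (v : Fin n → ℤ) :
    euclideanNorm v ^ 2 = ((ratVec v ⬝ᵥ ratVec v : ℚ) : ℝ) := by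
  rw [euclideanNorm, EuclideanSpace.norm_sq_eq]
  simp [ratVec, dotProduct, pow_two]

theorem sq_dotProduct_le {ι : Type} [Fintype ι] (v w : ι → ℚ) :
    (v ⬝ᵥ w) ^ 2 ≤ (v ⬝ᵥ v) * (w ⬝ᵥ w) := by
  simpa only [dotProduct, ← pow_two] using Finset.sum_mul_sq_le_sq_mul_sq Finset.univ v w

/-- A generating system of `d - 1` vectors is linearly independent: a vector orthogonal to the
lattice is orthogonal to all `q e_j`. -/
theorem det_ne_zero_of_span_eq {b : Fin (d - 1) → Fin (d - 1) → ℤ} (hq : q ≠ 0)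
    (h : Submodule.span ℤ (Set.range b) = lattice a) : (Matrix.of b).det ≠ 0 := by
  intro h0
  obtain ⟨w, hw, hbw⟩ := Matrix.exists_mulVec_eq_zero_iff.2 h0
  have hall : ∀ v ∈ lattice a, v ⬝ᵥ w = 0 := by
    intro v hv
    rw [← h] at hv
    induction hv using Submodule.span_induction with
    | mem x hx =>
      obtain ⟨k, rfl⟩ := hx
      exact congrFun hbw k
    | zero => exact zero_dotProduct w
    | add x y _ _ hx hy => rw [add_dotProduct, hx, hy, add_zero]
    | smul c x _ hx => rw [smul_dotProduct, hx, smul_zero]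
  refine hw (funext fun j => ?_)
  have hj : Pi.single j (q : ℤ) ∈ lattice a := by
    refine mem_lattice.2 (Finset.sum_eq_zero fun i _ => ?_)
    by_cases hij : i = j
    · subst hij
      simp
    · simp [hij]
  have := hall _ hj
  rw [single_dotProduct] at this
  exact (mul_eq_zero.1 this).resolve_left (by exact_mod_cast hq)

theorem image_Iio_eq_range (b : ℕ → Fin (d - 1) → ℤ) :
    b '' Set.Iio (d - 1) = Set.range fun i : Fin (d - 1) => b i := by
  ext x
  constructor
  · rintro ⟨k, hk, rfl⟩
    exact ⟨⟨k, hk⟩, rfl⟩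
  · rintro ⟨k, rfl⟩
    exact ⟨k, k.2, rfl⟩

theorem gramProd_ne_zero {b : ℕ → Fin (d - 1) → ℤ} (hq : q ≠ 0)
    (h : Submodule.span ℤ (b '' Set.Iio (d - 1)) = lattice a) :
    gramProd (fun k => ratVec (b k)) (d - 1) ≠ 0 := by
  rw [image_Iio_eq_range] at h
  have hdet := det_ne_zero_of_span_eq hq h
  have hG : (Matrix.of fun i j : Fin (d - 1) => ratVec (b i) ⬝ᵥ ratVec (b j)) =
      (Matrix.of (fun i : Fin (d - 1) => b i) *
        (Matrix.of fun i : Fin (d - 1) => b i).transpose).map (Int.castRingHom ℚ) := by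
    ext i j
    simp [Matrix.mul_apply, ratVec, dotProduct]
  rw [← det_gram (fun k => ratVec (b k)), hG, ← RingHom.mapMatrix_apply, ← RingHom.map_det,
    Matrix.det_mul, Matrix.det_transpose]
  simpa using hdet

theorem minHeight_nonneg (hd : 2 ≤ d) (hq : q ≠ 0) (a : Fin (d + 1) → ZMod q) :
    0 ≤ minHeight a := by
  obtain ⟨B, hB⟩ := (isLeast_minHeight hd hq a).1
  rw [← hB]
  exact Real.iSup_nonneg fun i => norm_nonneg _

theorem minHeight_sq_le {b : ℕ → Fin (d - 1) → ℤ} (hd : 2 ≤ d) (hq : q ≠ 0)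
    (h : Submodule.span ℤ (b '' Set.Iio (d - 1)) = lattice a) :
    minHeight a ^ 2 ≤
      ((∑ k ∈ Finset.range (d - 1), ratVec (b k) ⬝ᵥ ratVec (b k) : ℚ) : ℝ) := by
  rw [image_Iio_eq_range] at h
  have hli : LinearIndependent ℤ fun i : Fin (d - 1) => b i :=
    Matrix.linearIndependent_rows_of_det_ne_zero (det_ne_zero_of_span_eq hq h)
  let B : Module.Basis (Fin (d - 1)) ℤ (lattice a) :=
    (Module.Basis.span hli).map (LinearEquiv.ofEq _ _ h)
  have hB : ∀ i, (B i : Fin (d - 1) → ℤ) = b i := by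
    intro i
    simp [B, Module.Basis.span_apply]
  have hle : minHeight a ≤ basisHeight B := (isLeast_minHeight hd hq a).2 ⟨B, rfl⟩
  have : Nonempty (Fin (d - 1)) := ⟨⟨0, by omega⟩⟩
  obtain ⟨i, hi⟩ := exists_eq_ciSup_of_finite
    (f := fun i => euclideanNorm (B i : Fin (d - 1) → ℤ))
  rw [basisHeight, ← hi, hB] at hle
  refine (pow_le_pow_left₀ (minHeight_nonneg hd hq a) hle 2).trans ?_
  rw [euclideanNorm_sq]
  exact_mod_cast Finset.single_le_sum
    (f := fun k => ratVec (b k) ⬝ᵥ ratVec (b k)) (fun k _ => rat_dotProduct_self_nonneg _)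
    (Finset.mem_range.2 i.2)

/-- The last vector of the orthogonalization of any basis bounds the height from below: some
vector of every basis has a nonzero component in its direction, and such a component is an integer
multiple. -/
theorem le_minHeight_sq {b : ℕ → Fin (d - 1) → ℤ} {m : ℕ} (hm : d - 1 = m + 1) (hq : q ≠ 0)
    (h : Submodule.span ℤ (b '' Set.Iio (d - 1)) = lattice a) :
    ((gs (fun k => ratVec (b k)) m ⬝ᵥ gs (fun k => ratVec (b k)) m : ℚ) : ℝ) ≤
      minHeight a ^ 2 := by
  set g := gs (fun k => ratVec (b k)) m with hg
  have hpos : 0 < g ⬝ᵥ g := gs_pos_of_gramProd_ne_zero (gramProd_ne_zero hq h) (by omega)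
  have hint : ∀ v ∈ lattice a, ∃ c : ℤ, ratVec v ⬝ᵥ g = c * (g ⬝ᵥ g) := by
    intro v hv
    rw [← h] at hv
    induction hv using Submodule.span_induction with
    | mem x hx =>
      obtain ⟨k, hk, rfl⟩ := hx
      rw [Set.mem_Iio, hm, Nat.lt_succ_iff_lt_or_eq] at hk
      rcases hk with hk | rfl
      · exact ⟨0, by rw [hg, dotProduct_gs_of_lt (fun k => ratVec (b k)) hk]; simp⟩
      · exact ⟨1, by rw [hg, dotProduct_gs_self (fun k => ratVec (b k))]; simp⟩
    | zero => exact ⟨0, by simp [ratVec, dotProduct]⟩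
    | add x y _ _ hx hy =>
      obtain ⟨c, hc⟩ := hx
      obtain ⟨c', hc'⟩ := hy
      refine ⟨c + c', ?_⟩
      have : ratVec (x + y) = ratVec x + ratVec y := by ext; simp [ratVec]
      rw [this, add_dotProduct, hc, hc']
      push_cast
      ring
    | smul z x _ hx =>
      obtain ⟨c, hc⟩ := hx
      refine ⟨z * c, ?_⟩
      have : ratVec (z • x) = (z : ℚ) • ratVec x := by ext; simp [ratVec]
      rw [this, smul_dotProduct, hc, smul_eq_mul]
      push_cast
      ring
  obtain ⟨B, hB⟩ := (isLeast_minHeight (by omega) hq a).1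
  have hex : ∃ i, ratVec (B i : Fin (d - 1) → ℤ) ⬝ᵥ g ≠ 0 := by
    by_contra! hcon
    have hmem : b m ∈ lattice a := by
      rw [← h]
      exact Submodule.subset_span ⟨m, by rw [Set.mem_Iio]; omega, rfl⟩
    have hrepr := congrArg Subtype.val (B.sum_repr ⟨b m, hmem⟩)
    have h0 : ratVec (b m) ⬝ᵥ g = 0 := by
      have hval : b m = ∑ i, B.repr ⟨b m, hmem⟩ i • (B i : Fin (d - 1) → ℤ) := by
        simpa only [Submodule.coe_sum, Submodule.coe_smul] using hrepr.symm
      have hsum : ratVec (b m) =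
          ∑ i, (B.repr ⟨b m, hmem⟩ i : ℚ) • ratVec (B i : Fin (d - 1) → ℤ) := by
        ext l
        have hl := congrFun hval l
        simp only [Finset.sum_apply, Pi.smul_apply, smul_eq_mul] at hl
        simp only [Finset.sum_apply, Pi.smul_apply, smul_eq_mul, ratVec]
        rw [hl]
        push_cast
        rfl
      rw [hsum, sum_dotProduct]
      exact Finset.sum_eq_zero fun i _ => by rw [smul_dotProduct, hcon, smul_zero]
    rw [hg, dotProduct_gs_self (fun k => ratVec (b k))] at h0
    exact hpos.ne' h0
  obtain ⟨i, hi⟩ := hex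
  obtain ⟨c, hc⟩ := hint _ (B i).2
  have hc0 : c ≠ 0 := by
    rintro rfl
    simp [hc] at hi
  have hc1 : (1 : ℚ) ≤ (c : ℚ) ^ 2 := by
    have : 0 < c ^ 2 := by positivity
    exact_mod_cast this
  have hcs := sq_dotProduct_le (ratVec (B i : Fin (d - 1) → ℤ)) g
  rw [hc] at hcs
  have hle : g ⬝ᵥ g ≤ ratVec (B i : Fin (d - 1) → ℤ) ⬝ᵥ ratVec (B i : Fin (d - 1) → ℤ) := by
    refine le_of_mul_le_mul_right ?_ hpos
    nlinarith [mul_pos hpos hpos]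
  calc ((g ⬝ᵥ g : ℚ) : ℝ)
      ≤ ((ratVec (B i : Fin (d - 1) → ℤ) ⬝ᵥ ratVec (B i : Fin (d - 1) → ℤ) : ℚ) : ℝ) := by
        exact_mod_cast hle
    _ = euclideanNorm (B i : Fin (d - 1) → ℤ) ^ 2 := (euclideanNorm_sq _).symm
    _ ≤ minHeight a ^ 2 := by
        rw [← hB]
        exact pow_le_pow_left₀ (norm_nonneg _)
          (le_ciSup (f := fun i => euclideanNorm (B i : Fin (d - 1) → ℤ))
            (Set.finite_range _).bddAbove i) 2

/-- The matrix with the rows `q e_p` and `e_k - c_k e_p` for `k ≠ p`. -/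
def pivotBasis {n : ℕ} (q : ℤ) (p : Fin n) (c : Fin n → ℤ) (k l : Fin n) : ℤ :=
  if k = p then (if l = p then q else 0) else (if l = k then 1 else if l = p then -c k else 0)

theorem span_pivotBasis [Fact q.Prime] {p : Fin (d - 1)} {c : Fin (d - 1) → ℤ}
    (hp : a (Fin.castLE (by omega) p) ≠ 0)
    (hc : ∀ k, (c k : ZMod q) * a (Fin.castLE (by omega) p) = a (Fin.castLE (by omega) k)) :
    Submodule.span ℤ (Set.range (pivotBasis q p c)) = lattice a := by
  refine le_antisymm (Submodule.span_le.2 ?_) fun x hx => ?_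
  · rintro _ ⟨k, rfl⟩
    refine mem_lattice.2 ?_
    by_cases hk : k = p
    · refine Finset.sum_eq_zero fun i _ => ?_
      rw [pivotBasis, if_pos hk]
      split_ifs <;> simp
    · have : ∀ i : Fin (d - 1), (pivotBasis (q : ℤ) p c k i : ZMod q) *
          a (Fin.castLE (by omega) i) =
          (if i = k then a (Fin.castLE (by omega) k) else 0) -
            if i = p then a (Fin.castLE (by omega) k) else 0 := by
        intro i
        rw [pivotBasis, if_neg hk]
        by_cases h1 : i = k
        · subst h1
          simp [hk]
        · by_cases h2 : i = p
          · subst h2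
            simp [h1, hc]
          · simp [h1, h2]
      rw [Finset.sum_congr rfl fun i _ => this i]
      simp
  · set z : ℤ := x p + ∑ k ∈ Finset.univ.erase p, x k * c k with hz
    have hdvd : (q : ℤ) ∣ z := by
      rw [← ZMod.intCast_zmod_eq_zero_iff_dvd]
      refine (mul_eq_zero.1 ?_).resolve_right hp
      rw [mem_lattice, ← Finset.add_sum_erase _ _ (Finset.mem_univ p)] at hx
      rw [hz]
      push_cast
      rw [add_mul, Finset.sum_mul, ← hx]
      congr 1
      exact Finset.sum_congr rfl fun k _ => by rw [mul_assoc, hc]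
    obtain ⟨r, hr⟩ := hdvd
    have hx' : x = ∑ k, (if k = p then r else x k) • pivotBasis q p c k := by
      rw [← Finset.add_sum_erase _ _ (Finset.mem_univ p), if_pos rfl]
      have h1 : ∀ k ∈ Finset.univ.erase p, (if k = p then r else x k) • pivotBasis (q : ℤ) p c k =
          x k • pivotBasis (q : ℤ) p c k := by
        intro k hk
        rw [if_neg (Finset.ne_of_mem_erase hk)]
      rw [Finset.sum_congr rfl h1]
      ext l
      simp only [Pi.add_apply, Pi.smul_apply, Finset.sum_apply, smul_eq_mul]
      by_cases hl : l = p
      · subst hl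
        have h2 : ∀ k ∈ Finset.univ.erase l,
            x k * pivotBasis (q : ℤ) l c k l = - (x k * c k) := by
          intro k hk
          have hk' := Finset.ne_of_mem_erase hk
          simp [pivotBasis, hk', hk'.symm]
        rw [Finset.sum_congr rfl h2, Finset.sum_neg_distrib]
        simp only [pivotBasis, if_true]
        linarith
      · rw [Finset.sum_eq_single_of_mem l (by simp [hl])]
        · simp [pivotBasis, hl]
        · intro k hk hkl
          have hk' := Finset.ne_of_mem_erase hk
          simp [pivotBasis, hk', hl, hkl.symm]
    rw [hx']
    exact Submodule.sum_mem _ fun k _ =>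
      Submodule.smul_mem _ _ (Submodule.subset_span ⟨k, rfl⟩)

end

/-! ### The variables of the algorithm and its elementary steps -/

section

variable {d : ℕ}

/-- The variables of the algorithm: the input registers, a square matrix, and four scratch
variables. -/
abbrev Var (d : ℕ) : Type :=
  Fin (d + 2) ⊕ ((Fin (d - 1) × Fin (d - 1)) ⊕ Fin 4)

/-- The register of a variable. The input registers stay in place. -/
noncomputable def Var.reg : Var d → ℕ
  | .inl i => i
  | .inr w => d + 2 + Fintype.equivFin _ w

theorem Var.reg_injective : Function.Injective (Var.reg : Var d → ℕ) := by
  rintro (i | w) (i' | w') h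
  · exact congrArg _ (Fin.ext h)
  · have := i.2
    simp only [reg] at h
    omega
  · have := i'.2
    simp only [reg] at h
    omega
  · simp only [reg, Nat.add_left_cancel_iff, Fin.val_inj, EmbeddingLike.apply_eq_iff_eq] at h
    rw [h]

/-- The values of all variables, given by the input registers, the matrix, and the scratch
variables. -/
def Var.state (f : Fin (d + 2) → ℤ) (M : Fin (d - 1) → Fin (d - 1) → ℤ) (r : Fin 4 → ℤ) :
    Var d → ℤ :=
  Sum.elim f (Sum.elim (fun kl => M kl.1 kl.2) r)

theorem definable_state {V : Type} {f : (V → ℤ) → Fin (d + 2) → ℤ}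
    {M : (V → ℤ) → Fin (d - 1) → Fin (d - 1) → ℤ} {x y z w : (V → ℤ) → ℤ}
    (hf : ∀ i, Definable fun σ => f σ i) (hM : ∀ k l, Definable fun σ => M σ k l)
    (hx : Definable x) (hy : Definable y) (hz : Definable z) (hw : Definable w) (v : Var d) :
    Definable fun σ => Var.state (f σ) (M σ) ![x σ, y σ, z σ, w σ] v := by
  rcases v with i | ⟨k, l⟩ | j
  · exact hf i
  · exact hM k l
  · fin_cases j
    exacts [hx, hy, hz, hw]

theorem bitBounded_state {f : Fin (d + 2) → ℤ} {M : Fin (d - 1) → Fin (d - 1) → ℤ}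
    {x y z w : ℤ} {B : ℕ} (hf : ∀ i, (f i).natAbs < 2 ^ B) (hM : ∀ k l, (M k l).natAbs < 2 ^ B)
    (hx : x.natAbs < 2 ^ B) (hy : y.natAbs < 2 ^ B) (hz : z.natAbs < 2 ^ B)
    (hw : w.natAbs < 2 ^ B) : BitBounded (Var.state f M ![x, y, z, w]) B := by
  rintro (i | ⟨k, l⟩ | j)
  · exact hf i
  · exact hM k l
  · fin_cases j
    exacts [hx, hy, hz, hw]

/-- The register of the `k`-th coordinate of the input. -/
def coordIdx (k : Fin (d - 1)) : Fin (d + 2) :=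
  ⟨k + 1, by omega⟩

/-- The rows of the matrix, continued by zero. -/
def rows (M : Fin (d - 1) → Fin (d - 1) → ℤ) (k : ℕ) : Fin (d - 1) → ℤ :=
  if h : k < d - 1 then M ⟨k, h⟩ else 0

theorem rows_of_lt (M : Fin (d - 1) → Fin (d - 1) → ℤ) {k : ℕ} (h : k < d - 1) :
    rows M k = M ⟨k, h⟩ :=
  dif_pos h

/-- The matrix stored in the variables. -/
def matrixOf (σ : Var d → ℤ) (k l : Fin (d - 1)) : ℤ :=
  σ (.inr (.inl (k, l)))

theorem definable_rows (k : ℕ) (l : Fin (d - 1)) :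
    Definable fun σ : Var d → ℤ => rows (matrixOf σ) k l := by
  by_cases h : k < d - 1
  · simp only [rows_of_lt _ h]
    exact .var _
  · simp only [rows, h, dif_neg, not_false_eq_true]
    exact .const 0

/-- Prepares the computation of the inverse of the `p`-th coordinate: exponent, base,
accumulator. -/
def powInit (p : Fin (d - 1)) (σ : Var d → ℤ) : Var d → ℤ :=
  Var.state (fun i => σ (.inl i)) (fun _ _ => 0) ![σ (.inl 0) - 2, σ (.inl (coordIdx p)), 1, 0]

/-- One round of fast exponentiation modulo the first input register. -/
def powStep (σ : Var d → ℤ) : Var d → ℤ :=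
  Var.state (fun i => σ (.inl i)) (fun _ _ => 0)
    ![σ (.inr (.inr 0)) / 2,
      σ (.inr (.inr 1)) * σ (.inr (.inr 1)) % σ (.inl 0),
      if 0 < σ (.inr (.inr 0)) % 2 then σ (.inr (.inr 2)) * σ (.inr (.inr 1)) % σ (.inl 0)
        else σ (.inr (.inr 2)),
      0]

/-- Writes down the initial basis, given the inverse of the `p`-th coordinate. -/
def basisInit (p : Fin (d - 1)) (σ : Var d → ℤ) : Var d → ℤ :=
  Var.state (fun i => σ (.inl i))
    (pivotBasis (σ (.inl 0)) p fun k =>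
      σ (.inl (coordIdx k)) * σ (.inr (.inr 2)) % σ (.inl 0))
    ![1, 0, 0, 0]

/-- One round of the basis reduction. -/
def basisStep (σ : Var d → ℤ) : Var d → ℤ :=
  Var.state (fun i => σ (.inl i)) (fun k => reduceStep (rows (matrixOf σ)) (d - 2) k)
    ![unreducedFlag (rows (matrixOf σ)) (d - 2), 0, 0, 0]

/-- Prepares the computation of two bit sizes, the second number being the first input register
and the first one its product with the sum of the squares of the matrix entries. The first number
is thus at least as long as the second, and one loop serves both. -/
def sizeInit (σ : Var d → ℤ) : Var d → ℤ :=
  Var.state (fun i => σ (.inl i)) (fun _ _ => 0)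
    ![(∑ k, ∑ l, matrixOf σ k l * matrixOf σ k l) * σ (.inl 0), σ (.inl 0), 0, 0]

/-- Halves both numbers and counts the rounds in which they are positive. -/
def sizeStep (σ : Var d → ℤ) : Var d → ℤ :=
  Var.state (fun i => σ (.inl i)) (fun _ _ => 0)
    ![σ (.inr (.inr 0)) / 2, σ (.inr (.inr 1)) / 2,
      if 0 < σ (.inr (.inr 0)) then σ (.inr (.inr 2)) + 1 else σ (.inr (.inr 2)),
      if 0 < σ (.inr (.inr 1)) then σ (.inr (.inr 3)) + 1 else σ (.inr (.inr 3))]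

/-- Puts the result into the output registers. -/
def output (σ : Var d → ℤ) : Var d → ℤ :=
  Var.state (fun i => if i = 0 then σ (.inr (.inr 2)) - σ (.inr (.inr 3)) else
      2 * σ (.inr (.inr 3)))
    (fun _ _ => 0) ![0, 0, 0, 0]

theorem definable_powInit (p : Fin (d - 1)) (v : Var d) : Definable fun σ => powInit p σ v :=
  definable_state (fun _ => .var _) (fun _ _ => .const 0) (.sub (.var _) (.const 2)) (.var _)
    (.const 1) (.const 0) v

theorem definable_powStep (v : Var d) : Definable fun σ => powStep σ v :=
  definable_state (fun _ => .var _) (fun _ _ => .const 0) (.div (.var _) (.const 2))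
    (.emod (.mul (.var _) (.var _)) (.var _))
    (.ite (.emod (.var _) (.const 2)) (.emod (.mul (.var _) (.var _)) (.var _)) (.var _))
    (.const 0) v

theorem definable_basisInit (p : Fin (d - 1)) (v : Var d) :
    Definable fun σ => basisInit p σ v := by
  refine definable_state (fun _ => .var _) (fun k l => ?_) (.const 1) (.const 0) (.const 0)
    (.const 0) v
  simp only [pivotBasis]
  split_ifs
  · exact .var _
  · exact .const 0
  · exact .const 1
  · have h : Definable fun σ : Var d → ℤ =>
        0 - σ (.inl (coordIdx k)) * σ (.inr (.inr 2)) % σ (.inl 0) :=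
      .sub (.const 0) (.emod (.mul (.var _) (.var _)) (.var _))
    simpa only [zero_sub] using h
  · exact .const 0

theorem definable_basisStep (v : Var d) : Definable fun σ => basisStep σ v :=
  definable_state (fun _ => .var _) (fun _ _ => definable_reduceStep definable_rows _ _ _)
    (definable_unreducedFlag definable_rows _) (.const 0) (.const 0) (.const 0) v

theorem definable_sizeInit (v : Var d) : Definable fun σ => sizeInit σ v :=
  definable_state (fun _ => .var _) (fun _ _ => .const 0)
    (.mul (.sum _ fun _ => .sum _ fun _ => .mul (.var _) (.var _)) (.var _)) (.var _)
    (.const 0) (.const 0) v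

theorem definable_sizeStep (v : Var d) : Definable fun σ => sizeStep σ v :=
  definable_state (fun _ => .var _) (fun _ _ => .const 0) (.div (.var _) (.const 2))
    (.div (.var _) (.const 2)) (.ite (.var _) (.add (.var _) (.const 1)) (.var _))
    (.ite (.var _) (.add (.var _) (.const 1)) (.var _)) v

theorem definable_output (v : Var d) : Definable fun σ => output σ v := by
  refine definable_state (fun i => ?_) (fun _ _ => .const 0) (.const 0) (.const 0) (.const 0)
    (.const 0) v
  split_ifs
  · exact .sub (.var _) (.var _)
  · exact .mul (.const 2) (.var _)

end

/-! ### The initial basis -/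

section

variable {d : ℕ}

/-- The input registers. -/
def inputVars {q : ℕ} (a : Fin (d + 1) → ZMod q) (i : Fin (d + 2)) : ℤ :=
  input a i

theorem inputVars_coordIdx {q : ℕ} (a : Fin (d + 1) → ZMod q) (k : Fin (d - 1)) :
    inputVars a (coordIdx k) = ((a (Fin.castLE (by omega) k)).val : ℤ) := by
  have h : (k : ℕ) < d + 1 := by omega
  simp only [inputVars, coordIdx, input, h, dif_pos]
  rfl

theorem natAbs_inputVars_lt {q : ℕ} [NeZero q] (a : Fin (d + 1) → ZMod q) (i : Fin (d + 2)) :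
    (inputVars a i).natAbs < 2 ^ q.size := by
  refine lt_of_le_of_lt ?_ (Nat.lt_size_self q)
  rcases i with ⟨_ | i, hi⟩
  · exact le_of_eq (Int.natAbs_natCast q)
  · have h : i < d + 1 := by omega
    simp only [inputVars, input, h, dif_pos, Int.natAbs_natCast]
    exact (ZMod.val_lt _).le

theorem natAbs_pivotBasis_le {n q : ℕ} {p : Fin n} {c : Fin n → ℤ} (hq : 1 ≤ q)
    (hc : ∀ k, (c k).natAbs ≤ q) (k l : Fin n) : (pivotBasis q p c k l).natAbs ≤ q := by
  rw [pivotBasis]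
  split_ifs
  · exact le_of_eq (Int.natAbs_natCast q)
  · simp
  · simpa using hq
  · simpa using hc k
  · simp

/-- The initial basis is computed in polynomial time. Modulo `q`, the inverse of a nonzero residue
is its `(q - 2)`-th power. -/
theorem exists_program_basis (p : Fin (d - 1)) :
    ∃ (P : Program) (c : ℕ), ∀ (q : ℕ) [Fact q.Prime] (a : Fin (d + 1) → ZMod q),
      a (Fin.castLE (by omega) p) ≠ 0 → ∃ M : Fin (d - 1) → Fin (d - 1) → ℤ,
        Submodule.span ℤ (Set.range M) = lattice a ∧ (∀ k l, (M k l).natAbs ≤ q) ∧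
        Realizes Var.reg P (Var.state (inputVars a) (fun _ _ => 0) ![0, 0, 0, 0])
          (c * q.size ^ 3) (Var.state (inputVars a) M ![1, 0, 0, 0]) := by
  obtain ⟨P₁, c₁, h₁⟩ := exists_program_assign Var.reg_injective (definable_powInit p)
  obtain ⟨P₂, c₂, h₂⟩ := exists_program_loop Var.reg_injective (definable_powStep (d := d))
    (.inr (.inr 0))
  obtain ⟨P₃, c₃, h₃⟩ := exists_program_assign Var.reg_injective (definable_basisInit p)
  refine ⟨.seq P₁ (.seq P₂ P₃), c₁ + 2 * c₂ + c₃, fun q hq a ha => ?_⟩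
  have hq2 : 2 ≤ q := hq.out.two_le
  set B := q.size with hB
  have hB1 : 1 ≤ B := Nat.size_pos.2 (by omega)
  have hqB : q < 2 ^ B := Nat.lt_size_self q
  set α := a (Fin.castLE (by omega) p) with hα
  have hf := natAbs_inputVars_lt a
  have h0B : (0 : ℤ).natAbs < 2 ^ B := by simp
  let I : ℕ → (Var d → ℤ) → Prop := fun k σ => ∃ e x z : ℕ,
    σ = Var.state (inputVars a) (fun _ _ => 0) ![(e : ℤ), (x : ℤ), (z : ℤ), 0] ∧
      e < 2 ^ k ∧ e < q ∧ x < q ∧ z < q ∧ (z * x ^ e : ZMod q) = α ^ (q - 2)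
  have hI : ∀ k σ, I k σ → BitBounded σ B := by
    rintro k σ ⟨e, x, z, rfl, -, he, hx, hz, -⟩
    refine bitBounded_state hf (fun _ _ => h0B) ?_ ?_ ?_ h0B <;>
      exact (Int.natAbs_natCast _).trans_lt (by omega)
  have hstep : ∀ k σ, I k σ → 0 < σ (.inr (.inr 0)) → ∃ k', k = k' + 1 ∧ I k' (powStep σ) := by
    rintro k σ ⟨e, x, z, rfl, hek, he, hx, hz, hpow⟩ hpos
    have he0 : 0 < e := by
      have : (0 : ℤ) < (e : ℤ) := hpos
      exact_mod_cast this
    cases k with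
    | zero =>
      rw [pow_zero] at hek
      omega
    | succ k =>
      rw [pow_succ] at hek
      refine ⟨k, rfl, e / 2, x * x % q, if 0 < e % 2 then z * x % q else z, ?_, by omega, by omega,
        Nat.mod_lt _ (by omega), ?_, ?_⟩
      · change Var.state (inputVars a) (fun _ _ => 0) ![(e : ℤ) / 2, (x : ℤ) * x % (q : ℤ),
          if 0 < (e : ℤ) % 2 then (z : ℤ) * x % (q : ℤ) else z, 0] = _
        have hiff : 0 < (e : ℤ) % 2 ↔ 0 < e % 2 := by omega
        simp only [hiff]
        push_cast
        rfl
      · split_ifs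
        · exact Nat.mod_lt _ (by omega)
        · exact hz
      · rw [← hpow]
        have hxe : (x : ZMod q) ^ e = x ^ (2 * (e / 2) + e % 2) := by rw [Nat.div_add_mod]
        rw [hxe, ZMod.natCast_mod, pow_add, pow_mul]
        push_cast
        rw [← pow_two]
        split_ifs with h
        · rw [ZMod.natCast_mod, show e % 2 = 1 by omega]
          push_cast
          ring
        · rw [show e % 2 = 0 by omega]
          ring
  have hval : α.val < q := ZMod.val_lt α
  have hinit : I B (powInit p (Var.state (inputVars a) (fun _ _ => 0) ![0, 0, 0, 0])) := by
    refine ⟨q - 2, α.val, 1, ?_, by omega, by omega, hval, by omega, ?_⟩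
    · change Var.state (inputVars a) (fun _ _ => 0)
        ![(q : ℤ) - 2, inputVars a (coordIdx p), 1, 0] = _
      rw [inputVars_coordIdx]
      push_cast [hq2]
      rfl
    · rw [ZMod.natCast_zmod_val]
      simp
  obtain ⟨k', τ, ⟨e, x, z, rfl, -, -, hx, hz, hpow⟩, hτ, hrun⟩ := h₂ B I hB1 hI hstep B _ hinit
  have he0 : e = 0 := by
    have : (e : ℤ) ≤ 0 := hτ
    omega
  subst he0
  have hinv : (z : ZMod q) * α = 1 := by
    rw [pow_zero, mul_one] at hpow
    rw [hpow, ← pow_succ, show q - 2 + 1 = q - 1 by omega]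
    exact ZMod.pow_card_sub_one_eq_one ha
  set c : Fin (d - 1) → ℤ := fun k => inputVars a (coordIdx k) * (z : ℤ) % (q : ℤ) with hc
  refine ⟨pivotBasis q p c, span_pivotBasis ha fun k => ?_,
    natAbs_pivotBasis_le (by omega) fun k => ?_, ?_⟩
  · rw [hc]
    dsimp only
    rw [inputVars_coordIdx, ZMod.intCast_mod]
    push_cast
    rw [ZMod.natCast_zmod_val, mul_assoc, hinv, mul_one]
  · have hq0 : (0 : ℤ) < q := by omega
    have h1 := Int.emod_nonneg (inputVars a (coordIdx k) * (z : ℤ)) hq0.ne'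
    have h2 := Int.emod_lt_of_pos (inputVars a (coordIdx k) * (z : ℤ)) hq0
    simp only [hc]
    omega
  · refine ((h₁ _ B hB1 (bitBounded_state hf (fun _ _ => h0B) h0B h0B h0B h0B)).seq
      (hrun.seq (h₃ _ B hB1 ?_))).mono ?_
    · exact hI 0 _ ⟨0, x, z, rfl, by positivity, by omega, hx, hz, hpow⟩
    · have h3 : B ^ 2 ≤ B ^ 3 := Nat.pow_le_pow_right hB1 (by norm_num)
      have h4 : (B + 1) * B ^ 2 ≤ 2 * B ^ 3 := by
        rw [pow_succ B 2]
        nlinarith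
      calc c₁ * B ^ 2 + ((B + 1) * (c₂ * B ^ 2) + c₃ * B ^ 2)
          = c₁ * B ^ 2 + (c₂ * ((B + 1) * B ^ 2) + c₃ * B ^ 2) := by ring
        _ ≤ c₁ * B ^ 3 + (c₂ * (2 * B ^ 3) + c₃ * B ^ 3) := by gcongr
        _ = (c₁ + 2 * c₂ + c₃) * B ^ 3 := by ring

end

/-! ### The basis reduction in polynomial time -/

section

variable {d : ℕ}

theorem potential_congr {ι : Type} [Fintype ι] {b b' : ℕ → ι → ℤ} {n : ℕ}
    (h : ∀ k < n, b k = b' k) : potential b n = potential b' n := by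
  refine Finset.prod_congr rfl fun k hk => gramProd_congr fun j hj => ?_
  rw [h j (hj.trans (Finset.mem_range.1 hk))]

theorem image_rows (M : Fin (d - 1) → Fin (d - 1) → ℤ) :
    rows M '' Set.Iio (d - 1) = Set.range M := by
  rw [image_Iio_eq_range]
  congr 1
  ext1 i
  rw [rows_of_lt M i.2]

theorem ratVec_dotProduct_self {ι : Type} [Fintype ι] (v : ι → ℤ) :
    ratVec v ⬝ᵥ ratVec v = ((∑ l, v l * v l : ℤ) : ℚ) := by
  simp [ratVec, dotProduct]

theorem sum_rows (M : Fin (d - 1) → Fin (d - 1) → ℤ) :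
    ∑ k ∈ Finset.range (d - 1), ratVec (rows M k) ⬝ᵥ ratVec (rows M k) =
      ((∑ k, ∑ l, M k l * M k l : ℤ) : ℚ) := by
  rw [← Fin.sum_univ_eq_sum_range (fun k => ratVec (rows M k) ⬝ᵥ ratVec (rows M k)), Int.cast_sum]
  refine Finset.sum_congr rfl fun k _ => ?_
  rw [ratVec_dotProduct_self, rows_of_lt M k.2]

theorem natAbs_lt_of_row_le {M : Fin (d - 1) → Fin (d - 1) → ℤ} {B : ℕ} {k : Fin (d - 1)}
    (h : ratVec (rows M k) ⬝ᵥ ratVec (rows M k) ≤ 2 ^ B) (l : Fin (d - 1)) :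
    (M k l).natAbs < 2 ^ (B + 1) := by
  rw [rows_of_lt M k.2, ratVec_dotProduct_self] at h
  have h1 : ∑ l, M k l * M k l ≤ 2 ^ B := by exact_mod_cast h
  have h2 : M k l * M k l ≤ 2 ^ B :=
    (Finset.single_le_sum (f := fun l => M k l * M k l)
      (fun l _ => mul_self_nonneg _) (Finset.mem_univ l)).trans h1
  have h3 : (M k l).natAbs * (M k l).natAbs ≤ 2 ^ B := by
    zify
    rwa [abs_mul_abs_self]
  have h4 := Nat.le_mul_self (M k l).natAbs
  have h5 : 0 < 2 ^ B := by positivity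
  rw [pow_succ]
  omega

/-- Three swaps more than halve the potential, since `(4 / 3) ^ 3 > 2`. -/
theorem two_pow_lt (N : ℕ) : (2 : ℚ) ^ N < (4 / 3) ^ (3 * N + 1) := by
  have h : (2 : ℚ) ^ N ≤ ((4 / 3) ^ 3) ^ N := pow_le_pow_left₀ (by norm_num) (by norm_num) N
  rw [pow_succ, pow_mul]
  have : (0 : ℚ) < ((4 / 3) ^ 3) ^ N := by positivity
  linarith

/-- A reduced basis is computed in polynomial time. The sum of its squared lengths is the square of
the minimal height up to a constant factor. -/
theorem exists_program_reduce (hd : 3 ≤ d) :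
    ∃ (P : Program) (c κ C : ℕ), ∀ (q : ℕ) [Fact q.Prime] (a : Fin (d + 1) → ZMod q)
      (M : Fin (d - 1) → Fin (d - 1) → ℤ), Submodule.span ℤ (Set.range M) = lattice a →
      (∀ k l, (M k l).natAbs ≤ q) → ∃ M' : Fin (d - 1) → Fin (d - 1) → ℤ,
        minHeight a ^ 2 ≤ ((∑ k, ∑ l, M' k l * M' k l : ℤ) : ℝ) ∧
        ((∑ k, ∑ l, M' k l * M' k l : ℤ) : ℝ) ≤ C * minHeight a ^ 2 ∧
        ∑ k, ∑ l, M' k l * M' k l < 2 ^ (κ * q.size) ∧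
        (∀ k l, (M' k l).natAbs < 2 ^ (κ * q.size)) ∧
        Realizes Var.reg P (Var.state (inputVars a) M ![1, 0, 0, 0])
          (c * q.size ^ 3) (Var.state (inputVars a) M' ![0, 0, 0, 0]) := by
  obtain ⟨P, c, hP⟩ := exists_program_loop Var.reg_injective (definable_basisStep (d := d))
    (.inr (.inr 0))
  set n := d - 1 with hn
  set m := d - 2 with hm
  have hnm : n = m + 1 := by omega
  set κ₀ := 3 * ((n + 2) * (n * n)) + 1 with hκ₀
  set κ := n * κ₀ + n + 2 + n with hκ
  refine ⟨P, (κ₀ + 1) * (c * κ ^ 2), κ, n ^ 2 * 2 ^ m, fun q hq a M hM hMq => ?_⟩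
  have hq2 : 2 ≤ q := hq.out.two_le
  set L := q.size with hL
  have hL1 : 1 ≤ L := Nat.size_pos.2 (by omega)
  set K := κ₀ * L with hK
  set M₀ : ℚ := n * 4 ^ L with hM₀
  have hn2 : n ≤ 2 ^ (n * L) :=
    (Nat.lt_two_pow_self).le.trans
      (Nat.pow_le_pow_right (by norm_num) (Nat.le_mul_of_pos_right n hL1))
  have hnQ : (1 : ℚ) ≤ n := by
    have : 1 ≤ n := by omega
    exact_mod_cast this
  have hM₀1 : 1 ≤ M₀ := one_le_mul_of_one_le_of_one_le hnQ (one_le_pow₀ (by norm_num))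
  have hM₀le : M₀ ≤ 2 ^ ((n + 2) * L) := by
    have h4 : (4 : ℚ) ^ L = 2 ^ (2 * L) := by rw [pow_mul]; norm_num
    rw [hM₀, h4, add_mul, pow_add]
    gcongr
    exact_mod_cast hn2
  -- A bound for the squared lengths of all vectors that ever occur.
  have hbound : ∀ k ≤ K, (n : ℚ) ^ (K - k) * M₀ ≤ 2 ^ ((n * κ₀ + n + 2) * L) := by
    intro k hk
    have h1 : (n : ℚ) ^ (K - k) ≤ 2 ^ (n * K) := by
      calc (n : ℚ) ^ (K - k) ≤ (n : ℚ) ^ K := pow_le_pow_right₀ hnQ (Nat.sub_le _ _)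
        _ ≤ (2 ^ n) ^ K := by
          gcongr
          exact_mod_cast (Nat.lt_two_pow_self (n := n)).le
        _ = 2 ^ (n * K) := (pow_mul _ _ _).symm
    calc (n : ℚ) ^ (K - k) * M₀ ≤ 2 ^ (n * K) * 2 ^ ((n + 2) * L) := by gcongr
      _ = 2 ^ ((n * κ₀ + n + 2) * L) := by rw [← pow_add, hK]; ring_nf
  have hκB : (n * κ₀ + n + 2) * L + 1 ≤ κ * L := by
    rw [hκ, add_mul _ n L]
    have : 1 ≤ n * L := Nat.mul_pos (by omega) hL1
    omega
  have hB1 : 1 ≤ κ * L := by omega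
  have hfB : ∀ i, (inputVars a i).natAbs < 2 ^ (κ * L) := fun i =>
    (natAbs_inputVars_lt a i).trans_le (Nat.pow_le_pow_right (by norm_num)
      (Nat.le_mul_of_pos_left L (by omega)))
  have h0B : (0 : ℤ).natAbs < 2 ^ (κ * L) := by simp
  have h1B : (1 : ℤ).natAbs < 2 ^ (κ * L) := Nat.one_lt_two_pow (by omega)
  -- With `k` rounds left, the potential of an unreduced basis is below `(4 / 3) ^ k`, so `k` cannot
  -- be `0`: the potential is at least `1`.
  let I : ℕ → (Var d → ℤ) → Prop := fun k σ => ∃ (M : Fin (d - 1) → Fin (d - 1) → ℤ) (s : ℤ),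
    σ = Var.state (inputVars a) M ![s, 0, 0, 0] ∧ k ≤ K ∧
      Submodule.span ℤ (Set.range M) = lattice a ∧
      (∀ i < n, ratVec (rows M i) ⬝ᵥ ratVec (rows M i) ≤ n ^ (K - k) * M₀) ∧
      (s = 1 ∧ potential (rows M) n < (4 / 3) ^ k ∨
        s = 0 ∧ ((∑ k, ∑ l, M k l * M k l : ℤ) : ℝ) ≤
          ((n ^ 2 * 2 ^ m : ℕ) : ℝ) * minHeight a ^ 2)
  have hentries : ∀ (M : Fin (d - 1) → Fin (d - 1) → ℤ) (k : ℕ), k ≤ K →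
      (∀ i < n, ratVec (rows M i) ⬝ᵥ ratVec (rows M i) ≤ n ^ (K - k) * M₀) →
      ∀ i l, (M i l).natAbs < 2 ^ (κ * L) := by
    intro M k hk hrow i l
    exact (natAbs_lt_of_row_le ((hrow i i.2).trans (hbound k hk)) l).trans_le
      (Nat.pow_le_pow_right (by norm_num) hκB)
  have hI : ∀ k σ, I k σ → BitBounded σ (κ * L) := by
    rintro k σ ⟨M, s, rfl, hk, -, hrow, hs⟩
    refine bitBounded_state hfB (hentries M k hk hrow) ?_ h0B h0B h0B
    rcases hs with ⟨rfl, -⟩ | ⟨rfl, -⟩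
    · exact h1B
    · exact h0B
  have hstep : ∀ k σ, I k σ → 0 < σ (.inr (.inr 0)) → ∃ k', k = k' + 1 ∧ I k' (basisStep σ) := by
    rintro k σ ⟨M, s, rfl, hk, hspan, hrow, hs⟩ hpos
    have hs1 : s = 1 ∧ potential (rows M) n < (4 / 3) ^ k := by
      rcases hs with hs | ⟨rfl, -⟩
      · exact hs
      · exact absurd hpos (lt_irrefl 0)
    obtain ⟨rfl, hpot⟩ := hs1
    have hspan' : Submodule.span ℤ (rows M '' Set.Iio (d - 1)) = lattice a := by
      rw [image_rows, hspan]
    have hgram := gramProd_ne_zero (by omega) hspan'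
    cases k with
    | zero =>
      have := one_le_potential hgram
      rw [pow_zero] at hpot
      exact absurd (this.trans_lt hpot) (lt_irrefl 1)
    | succ k =>
      set M' : Fin (d - 1) → Fin (d - 1) → ℤ := fun i => reduceStep (rows M) m i with hM'
      have hrows : ∀ i < n, rows M' i = reduceStep (rows M) m i := fun i hi => rows_of_lt M' hi
      refine ⟨k, rfl, M', unreducedFlag (rows M) m, rfl, by omega, ?_, fun i hi => ?_, ?_⟩
      · have himage : rows M' '' Set.Iio n = reduceStep (rows M) m '' Set.Iio n :=
          Set.image_congr fun i hi => hrows i hi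
        have h1 := span_reduceStep (rows M) m
        rw [← hnm] at h1
        rw [← image_rows]
        exact (congrArg _ himage).trans (h1.trans hspan')
      · rw [hrows i hi]
        refine (reduceStep_dotProduct_self_le (rows M)
          (fun j hj => hrow j (by omega)) (by omega)).trans_eq ?_
        rw [show K - k = K - (k + 1) + 1 by omega, pow_succ]
        have : (m : ℚ) + 1 = n := by rw [hnm]; push_cast; rfl
        rw [this]
        ring
      · rcases reduceStep_cases (rows M) m with ⟨hflag, hred, hno⟩ | ⟨hflag, i, hi, hun, hred⟩
        · refine .inr ⟨hflag, ?_⟩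
          have hsum : ((∑ k, ∑ l, M' k l * M' k l : ℤ) : ℚ) =
              ∑ k ∈ Finset.range (m + 1),
                ratVec (sizeReduce (rows M) k) ⬝ᵥ ratVec (sizeReduce (rows M) k) := by
            rw [← sum_rows, show Finset.range (d - 1) = Finset.range (m + 1) by rw [← hnm]]
            refine Finset.sum_congr rfl fun i hi => ?_
            rw [hrows i (by rw [hnm]; exact Finset.mem_range.1 hi), hred]
          have h1 := sum_sizeReduce_le hno
          rw [← hsum] at h1
          have h2 : ((∑ k, ∑ l, M' k l * M' k l : ℤ) : ℝ) ≤ ((n ^ 2 * 2 ^ m : ℕ) : ℝ) *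
              ((gs (fun k => ratVec (rows M k)) m ⬝ᵥ
                gs (fun k => ratVec (rows M k)) m : ℚ) : ℝ) := by
            rw [hnm]
            exact_mod_cast h1
          exact h2.trans (mul_le_mul_of_nonneg_left (le_minHeight_sq hnm (by omega) hspan')
            (by positivity))
        · refine .inl ⟨hflag, ?_⟩
          have h1 := potential_swap_le hi hun
          rw [← hred, ← hnm] at h1
          rw [potential_congr hrows]
          rw [pow_succ] at hpot
          linarith
  have hrow₀ : ∀ i < n, ratVec (rows M i) ⬝ᵥ ratVec (rows M i) ≤ M₀ := by
    intro i hi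
    rw [rows_of_lt M hi]
    have hle : ∀ l ∈ Finset.univ, ratVec (M ⟨i, hi⟩) l * ratVec (M ⟨i, hi⟩) l ≤ (4 : ℚ) ^ L := by
      intro l _
      have h1 : (M ⟨i, hi⟩ l).natAbs < 2 ^ L := (hMq _ l).trans_lt (Nat.lt_size_self q)
      have h2 : (M ⟨i, hi⟩ l).natAbs * (M ⟨i, hi⟩ l).natAbs ≤ 4 ^ L := by
        calc _ ≤ 2 ^ L * 2 ^ L := Nat.mul_le_mul h1.le h1.le
          _ = 4 ^ L := by rw [← mul_pow]; norm_num
      have h3 : M ⟨i, hi⟩ l * M ⟨i, hi⟩ l ≤ 4 ^ L := by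
        rw [← Int.natAbs_mul_self]
        exact_mod_cast h2
      change ((M ⟨i, hi⟩ l : ℤ) : ℚ) * (M ⟨i, hi⟩ l : ℤ) ≤ 4 ^ L
      exact_mod_cast h3
    refine (Finset.sum_le_card_nsmul _ _ _ hle).trans_eq ?_
    rw [Finset.card_univ, Fintype.card_fin, nsmul_eq_mul]
  have hinit : I K (Var.state (inputVars a) M ![1, 0, 0, 0]) := by
    refine ⟨M, 1, rfl, le_rfl, hM, by simpa using hrow₀, .inl ⟨rfl, ?_⟩⟩
    calc potential (rows M) n ≤ M₀ ^ (n * n) := potential_le hM₀1 hrow₀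
      _ ≤ (2 ^ ((n + 2) * L)) ^ (n * n) := by gcongr
      _ = 2 ^ ((n + 2) * (n * n) * L) := by rw [← pow_mul]; ring_nf
      _ < (4 / 3) ^ (3 * ((n + 2) * (n * n) * L) + 1) := two_pow_lt _
      _ ≤ (4 / 3) ^ K := by
        refine pow_le_pow_right₀ (by norm_num) ?_
        rw [hK, hκ₀, add_mul _ 1 L, one_mul]
        have : 3 * ((n + 2) * (n * n) * L) = 3 * ((n + 2) * (n * n)) * L := by ring
        omega
  obtain ⟨k', τ, ⟨M', s, rfl, hk', hspan, hrow, hs⟩, hτ, hrun⟩ :=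
    hP (κ * L) I hB1 hI hstep K _ hinit
  have hs0 : s = 0 ∧ ((∑ k, ∑ l, M' k l * M' k l : ℤ) : ℝ) ≤
      ((n ^ 2 * 2 ^ m : ℕ) : ℝ) * minHeight a ^ 2 := by
    rcases hs with ⟨rfl, -⟩ | hs
    · exact absurd hτ (by change ¬ (1 : ℤ) ≤ 0; norm_num)
    · exact hs
  obtain ⟨rfl, hC⟩ := hs0
  refine ⟨M', ?_, hC, ?_, hentries M' k' hk' hrow, hrun.mono ?_⟩
  · have h1 := minHeight_sq_le (a := a) (b := rows M') (by omega) (by omega)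
      (by rw [image_rows, hspan])
    rw [sum_rows] at h1
    exact_mod_cast h1
  · have h1 : ((∑ k, ∑ l, M' k l * M' k l : ℤ) : ℚ) ≤ n * 2 ^ ((n * κ₀ + n + 2) * L) := by
      rw [← sum_rows]
      refine (Finset.sum_le_card_nsmul _ _ _ fun i hi =>
        (hrow i (Finset.mem_range.1 hi)).trans (hbound k' hk')).trans_eq ?_
      rw [Finset.card_range, nsmul_eq_mul]
    have h2 : ∑ k, ∑ l, M' k l * M' k l ≤ n * 2 ^ ((n * κ₀ + n + 2) * L) := by exact_mod_cast h1
    refine h2.trans_lt ?_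
    have h3 : (n : ℤ) < 2 ^ (n * L) := by
      have : n < 2 ^ (n * L) := Nat.lt_two_pow_self.trans_le
        (Nat.pow_le_pow_right (by norm_num) (Nat.le_mul_of_pos_right n hL1))
      exact_mod_cast this
    rw [hκ, add_mul _ n L, pow_add, mul_comm]
    exact mul_lt_mul_of_pos_left h3 (by positivity)
  · calc (K + 1) * (c * (κ * L) ^ 2) ≤ ((κ₀ + 1) * L) * (c * (κ * L) ^ 2) := by
          gcongr
          rw [hK, add_mul κ₀ 1 L]
          omega
      _ = (κ₀ + 1) * (c * κ ^ 2) * L ^ 3 := by ring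

end

/-! ### The output -/

section

variable {d : ℕ}

theorem size_div_two_add_one {x : ℕ} (hx : 0 < x) : (x / 2).size + 1 = x.size := by
  conv_rhs => rw [← Nat.bit_bodd_div2 x]
  rw [Nat.size_bit (by rw [Nat.bit_bodd_div2]; omega), Nat.div2_val]

/-- The final quotient of bit lengths is computed in polynomial time. -/
theorem exists_program_size (d κ : ℕ) :
    ∃ (P : Program) (c : ℕ), ∀ (q : ℕ) [Fact q.Prime] (a : Fin (d + 1) → ZMod q)
      (M : Fin (d - 1) → Fin (d - 1) → ℤ) (X : ℕ), ∑ k, ∑ l, M k l * M k l = X → 0 < X →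
      X < 2 ^ (κ * q.size) → (∀ k l, (M k l).natAbs < 2 ^ (κ * q.size)) → ∃ τ : Var d → ℤ,
        τ (.inl 0) = (X * q).size - q.size ∧ τ (.inl 1) = 2 * q.size ∧
        Realizes Var.reg P (Var.state (inputVars a) M ![0, 0, 0, 0]) (c * q.size ^ 3) τ := by
  obtain ⟨P₁, c₁, h₁⟩ := exists_program_assign Var.reg_injective (definable_sizeInit (d := d))
  obtain ⟨P₂, c₂, h₂⟩ := exists_program_loop Var.reg_injective (definable_sizeStep (d := d))
    (.inr (.inr 0))
  obtain ⟨P₃, c₃, h₃⟩ := exists_program_assign Var.reg_injective (definable_output (d := d))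
  refine ⟨.seq P₁ (.seq P₂ P₃), (c₁ + (κ + 2) * c₂ + c₃) * (κ + 1) ^ 2,
    fun q hq a M X hX hX0 hXκ hM => ?_⟩
  have hq2 : 2 ≤ q := hq.out.two_le
  set L := q.size with hL
  have hL1 : 1 ≤ L := Nat.size_pos.2 (by omega)
  set B := (κ + 1) * L with hB
  have hBL : B = κ * L + L := by rw [hB, add_mul, one_mul]
  have hB1 : 1 ≤ B := by omega
  have hNB : X * q < 2 ^ B := by
    rw [hBL, pow_add]
    exact Nat.mul_lt_mul'' hXκ (Nat.lt_size_self q)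
  have hf : ∀ i, (inputVars a i).natAbs < 2 ^ B := fun i =>
    (natAbs_inputVars_lt a i).trans_le (Nat.pow_le_pow_right (by norm_num) (by omega))
  have h0B : (0 : ℤ).natAbs < 2 ^ B := by simp
  have hsize : ∀ u ≤ B, u < 2 ^ B := fun u hu => hu.trans_lt Nat.lt_two_pow_self
  have hsizeN : (X * q).size ≤ B := Nat.size_le.2 hNB
  -- The counters `u` and `v` hold the numbers of bits of `X * q` and of `q` already cut off.
  let I : ℕ → (Var d → ℤ) → Prop := fun k σ => ∃ x y u v : ℕ,
    σ = Var.state (inputVars a) (fun _ _ => 0) ![(x : ℤ), (y : ℤ), (u : ℤ), (v : ℤ)] ∧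
      y ≤ x ∧ x < 2 ^ k ∧ x < 2 ^ B ∧ x.size + u = (X * q).size ∧ y.size + v = q.size
  have hI : ∀ k σ, I k σ → BitBounded σ B := by
    rintro k σ ⟨x, y, u, v, rfl, hyx, -, hx, hu, hv⟩
    refine bitBounded_state hf (fun _ _ => h0B) ?_ ?_ ?_ ?_ <;>
      refine (Int.natAbs_natCast _).trans_lt ?_
    · exact hx
    · omega
    · exact hsize u (by omega)
    · exact hsize v (by omega)
  have hstep : ∀ k σ, I k σ → 0 < σ (.inr (.inr 0)) → ∃ k', k = k' + 1 ∧ I k' (sizeStep σ) := by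
    rintro k σ ⟨x, y, u, v, rfl, hyx, hxk, hx, hu, hv⟩ hpos
    have hx0 : 0 < x := by
      have : (0 : ℤ) < (x : ℤ) := hpos
      exact_mod_cast this
    cases k with
    | zero =>
      rw [pow_zero] at hxk
      omega
    | succ k =>
      rw [pow_succ] at hxk
      refine ⟨k, rfl, x / 2, y / 2, if 0 < x then u + 1 else u, if 0 < y then v + 1 else v, ?_,
        by omega, by omega, by omega, ?_, ?_⟩
      · change Var.state (inputVars a) (fun _ _ => 0) ![(x : ℤ) / 2, (y : ℤ) / 2,
          if 0 < (x : ℤ) then (u : ℤ) + 1 else u, if 0 < (y : ℤ) then (v : ℤ) + 1 else v] = _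
        simp only [Int.natCast_pos]
        push_cast
        rfl
      · rw [if_pos hx0, ← hu, ← size_div_two_add_one hx0]
        ring
      · split_ifs with hy
        · rw [← hv, ← size_div_two_add_one hy]
          ring
        · rw [← hv, show y = 0 by omega]
  have hinit : I B (sizeInit (Var.state (inputVars a) M ![0, 0, 0, 0])) := by
    refine ⟨X * q, q, 0, 0, ?_, Nat.le_mul_of_pos_left q hX0, hNB, hNB, rfl, rfl⟩
    change Var.state (inputVars a) (fun _ _ => 0)
      ![(∑ k, ∑ l, M k l * M k l) * (q : ℤ), (q : ℤ), 0, 0] = _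
    rw [hX]
    push_cast
    rfl
  obtain ⟨k', τ, hτI, hτ, hrun⟩ := h₂ B I hB1 hI hstep B _ hinit
  have hbτ := hI _ _ hτI
  obtain ⟨x, y, u, v, rfl, hyx, -, -, hu, hv⟩ := hτI
  have hx0 : x = 0 := by
    have : (x : ℤ) ≤ 0 := hτ
    omega
  obtain rfl : y = 0 := by omega
  subst hx0
  rw [Nat.size_zero, zero_add] at hu hv
  refine ⟨_, ?_, ?_, ((h₁ _ B hB1 (bitBounded_state hf (fun k l => ?_) h0B h0B h0B h0B)).seq
    (hrun.seq (h₃ _ B hB1 hbτ))).mono ?_⟩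
  · rw [← hu, hL, ← hv]
    rfl
  · rw [hL, ← hv]
    rfl
  · exact (hM k l).trans_le (Nat.pow_le_pow_right (by norm_num) (by omega))
  · have h3 : L ^ 2 ≤ L ^ 3 := Nat.pow_le_pow_right hL1 (by norm_num)
    have h4 : B + 1 ≤ (κ + 2) * L := by
      rw [hB, show (κ + 2) * L = (κ + 1) * L + L by ring]
      omega
    calc c₁ * B ^ 2 + ((B + 1) * (c₂ * B ^ 2) + c₃ * B ^ 2)
        = c₁ * ((κ + 1) ^ 2 * L ^ 2) + ((B + 1) * (c₂ * ((κ + 1) ^ 2 * L ^ 2)) +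
            c₃ * ((κ + 1) ^ 2 * L ^ 2)) := by rw [hB]; ring
      _ ≤ c₁ * ((κ + 1) ^ 2 * L ^ 3) + ((κ + 2) * L * (c₂ * ((κ + 1) ^ 2 * L ^ 2)) +
            c₃ * ((κ + 1) ^ 2 * L ^ 3)) := by gcongr
      _ = (c₁ + (κ + 2) * c₂ + c₃) * (κ + 1) ^ 2 * L ^ 3 := by ring

theorem log_le_size_mul (n : ℕ) (hn : 0 < n) : Real.log n ≤ n.size * Real.log 2 := by
  rw [← Real.log_pow]
  refine Real.log_le_log (by exact_mod_cast hn) ?_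
  exact_mod_cast (Nat.lt_size_self n).le

theorem size_sub_one_mul_le_log (n : ℕ) (hn : 0 < n) :
    ((n.size : ℝ) - 1) * Real.log 2 ≤ Real.log n := by
  have hs : 1 ≤ n.size := Nat.size_pos.2 hn
  have h1 : 2 ^ (n.size - 1) ≤ n := Nat.lt_size.1 (by omega)
  have h2 : ((n.size - 1 : ℕ) : ℝ) = (n.size : ℝ) - 1 := by
    push_cast [hs]
    rfl
  rw [← h2, ← Real.log_pow]
  refine Real.log_le_log (by positivity) ?_
  exact_mod_cast h1

/-- The quotient of bit sizes approximates the quotient of logarithms. -/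
theorem abs_size_div_size_sub_logb_le {q X c : ℕ} {h C : ℝ} (hq : 2 ≤ q) (hX : 0 < X)
    (hh : 0 < h) (hle : h ^ 2 ≤ X) (hge : X ≤ C * h ^ 2) (hC : 1 ≤ C)
    (hsize : (X * q).size ≤ c * q.size) :
    |((((X * q).size : ℝ) - q.size) / (2 * q.size)) - Real.logb q h| ≤
      ((c + 1) * Real.log 2 + Real.log C) / Real.log q := by
  have hq1 : (1 : ℝ) < q := by exact_mod_cast hq
  have hQ : 0 < Real.log q := Real.log_pos hq1
  have hs1 : (1 : ℝ) ≤ q.size := by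
    exact_mod_cast Nat.size_pos.2 (by omega : 0 < q)
  have hX0 : (0 : ℝ) < X := by exact_mod_cast hX
  have hXq : Real.log ((X * q : ℕ) : ℝ) = Real.log X + Real.log q := by
    push_cast
    exact Real.log_mul hX0.ne' (by linarith)
  have a1 := log_le_size_mul q (by omega)
  have a2 := size_sub_one_mul_le_log q (by omega)
  have a3 := log_le_size_mul (X * q) (by positivity)
  have a4 := size_sub_one_mul_le_log (X * q) (by positivity)
  have a5 : 2 * Real.log h ≤ Real.log X := by
    rw [← Real.log_rpow hh]
    refine Real.log_le_log (by positivity) ?_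
    exact_mod_cast hle
  have a6 : Real.log X ≤ Real.log C + 2 * Real.log h := by
    rw [← Real.log_rpow hh, ← Real.log_mul (by linarith) (by positivity)]
    refine Real.log_le_log hX0 ?_
    exact_mod_cast hge
  have a7 : 0 ≤ Real.log C := Real.log_nonneg hC
  have a8 : 0 < Real.log 2 := Real.log_pos (by norm_num)
  have hmono : (q.size : ℝ) ≤ (X * q).size := by
    exact_mod_cast Nat.size_le_size (Nat.le_mul_of_pos_left q hX)
  have hsize' : ((X * q).size : ℝ) ≤ c * q.size := by exact_mod_cast hsize
  rw [hXq] at a3 a4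
  set S : ℝ := Nat.cast (X * q).size
  set s : ℝ := Nat.cast q.size
  set Q := Real.log q
  set y := (S - s) / (2 * s) with hy
  have hys : y * (2 * s) = S - s := div_mul_cancel₀ _ (by positivity)
  have hy0 : 0 ≤ y := div_nonneg (by linarith) (by linarith)
  have hyc : y ≤ c := by
    rw [hy, div_le_iff₀ (by linarith)]
    nlinarith [Nat.cast_nonneg (α := ℝ) c]
  -- Both `y * s * log 2` and `log h` are half the logarithm of `X` up to a bounded error.
  have b1 : |y * Q - Real.log h| ≤ (c + 1) * Real.log 2 + Real.log C := by
    have e1 : 0 ≤ y * (s * Real.log 2 - Q) := mul_nonneg hy0 (by linarith)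
    have e2 : y * (s * Real.log 2 - Q) ≤ c * Real.log 2 :=
      mul_le_mul hyc (by linarith) (by linarith) (Nat.cast_nonneg c)
    have e3 : y * (s * Real.log 2) = (S - s) * Real.log 2 / 2 := by rw [← hys]; ring
    rw [mul_sub] at e1 e2
    rw [abs_le]
    constructor <;> linarith
  have b2 : (y - Real.log h / Q) * Q = y * Q - Real.log h := by
    rw [sub_mul, div_mul_cancel₀ _ hQ.ne']
  rw [← b2, abs_mul, abs_of_pos hQ] at b1
  rwa [Real.logb, le_div_iff₀ hQ]

/-- The algorithm for inputs with a nonzero coordinate at a given place. -/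
theorem exists_program_of_pivot (hd : 3 ≤ d) (p : Fin (d - 1)) :
    ∃ (P : Program) (c : ℕ) (C : ℝ), ∀ (q : ℕ) [Fact q.Prime] (a : Fin (d + 1) → ZMod q),
      a (Fin.castLE (by omega) p) ≠ 0 → ∃ (t : ℕ) (y : ℚ), Returns P (input a) t y ∧
        t ≤ c * q.size ^ 3 ∧ |(y : ℝ) - eta a| ≤ C / Real.log q := by
  obtain ⟨P₁, c₁, h₁⟩ := exists_program_basis p
  obtain ⟨P₂, c₂, κ, C, h₂⟩ := exists_program_reduce hd
  obtain ⟨P₃, c₃, h₃⟩ := exists_program_size d κ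
  refine ⟨.seq P₁ (.seq P₂ P₃), c₁ + c₂ + c₃,
    ((κ + 1 : ℕ) + 1) * Real.log 2 + Real.log (max C 1), fun q hq a ha => ?_⟩
  have hq2 : 2 ≤ q := hq.out.two_le
  obtain ⟨M, hM, hMq, hrun₁⟩ := h₁ q a ha
  obtain ⟨M', hle, hge, hlt, hentries, hrun₂⟩ := h₂ q a M hM hMq
  obtain ⟨X, hX⟩ := Int.eq_ofNat_of_zero_le
    (Finset.sum_nonneg fun k _ => Finset.sum_nonneg fun l _ => mul_self_nonneg (M' k l))
  have hh : 0 < minHeight a := by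
    have hspan : Submodule.span ℤ (rows M '' Set.Iio (d - 1)) = lattice a := by
      rw [image_rows, hM]
    have hpos := gs_pos_of_gramProd_ne_zero (gramProd_ne_zero (by omega) hspan)
      (i := d - 2) (by omega)
    have hle' := le_minHeight_sq (m := d - 2) (by omega) (by omega) hspan
    have hsq : 0 < minHeight a ^ 2 := lt_of_lt_of_le (by exact_mod_cast hpos) hle'
    exact (minHeight_nonneg (by omega) (by omega) a).lt_of_ne' (by
      rintro h
      simp [h] at hsq)
  rw [hX] at hle hge hlt
  rw [Int.cast_natCast] at hle hge
  have hX0 : 0 < X := by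
    have : (0 : ℝ) < X := lt_of_lt_of_le (by positivity) hle
    exact_mod_cast this
  have hXlt : X < 2 ^ (κ * q.size) := by exact_mod_cast hlt
  obtain ⟨τ, hτ0, hτ1, hrun₃⟩ := h₃ q a M' X hX hX0 hXlt hentries
  obtain ⟨t, s', hs', ht, hτ⟩ := (hrun₁.seq (hrun₂.seq hrun₃)) (input a) (by
    rintro (i | w)
    · rfl
    · have hin : input a (Var.reg (.inr w : Var d)) = 0 := by
        have h1 : Var.reg (.inr w : Var d) = d + 1 + Fintype.equivFin _ w + 1 := by
          simp only [Var.reg]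
          omega
        rw [h1, input, dif_neg (by omega)]
      rw [hin]
      rcases w with ⟨k, l⟩ | j
      · rfl
      · fin_cases j <;> rfl)
  have hs'0 : s' 0 = ((X * q).size : ℤ) - q.size := (hτ (.inl 0)).trans hτ0
  have hs'1 : s' 1 = 2 * (q.size : ℤ) := by
    have h1 : Var.reg (.inl 1 : Var d) = 1 := rfl
    rw [← hτ1, ← hτ (.inl 1), h1]
  have hsize1 : 0 < q.size := Nat.size_pos.2 (by omega)
  refine ⟨t, _, ⟨s', hs', by omega, rfl⟩, ht.trans_eq (by ring), ?_⟩
  have hsize : (X * q).size ≤ (κ + 1) * q.size := by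
    refine Nat.size_le.2 ?_
    rw [add_mul, one_mul, pow_add]
    exact Nat.mul_lt_mul'' hXlt (Nat.lt_size_self q)
  have hge' : (X : ℝ) ≤ max (C : ℝ) 1 * minHeight a ^ 2 :=
    hge.trans (mul_le_mul_of_nonneg_right (le_max_left _ _) (by positivity))
  have key := abs_size_div_size_sub_logb_le hq2 hX0 hh hle hge' (le_max_right _ _) hsize
  rw [hs'0, hs'1, eta]
  push_cast at key ⊢
  exact key

/-- The algorithm for inputs with a nonzero coordinate among the first `j`: it looks for one. -/
theorem exists_program_of_exists_pivot (hd : 3 ≤ d) (j : ℕ) (hj : j ≤ d - 1) :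
    ∃ (P : Program) (c : ℕ) (C : ℝ), ∀ (q : ℕ) [Fact q.Prime] (a : Fin (d + 1) → ZMod q),
      (∃ p : Fin (d - 1), (p : ℕ) < j ∧ a (Fin.castLE (by omega) p) ≠ 0) →
      ∃ (t : ℕ) (y : ℚ), Returns P (input a) t y ∧
        t ≤ c * q.size ^ 3 ∧ |(y : ℝ) - eta a| ≤ C / Real.log q := by
  induction j with
  | zero => exact ⟨.skip, 0, 0, fun q _ a ⟨p, hp, _⟩ => absurd hp (Nat.not_lt_zero _)⟩
  | succ j ih =>
    obtain ⟨P, c, C, h⟩ := ih (by omega)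
    let p : Fin (d - 1) := ⟨j, hj⟩
    obtain ⟨P', c', C', h'⟩ := exists_program_of_pivot hd p
    refine ⟨.cond (j + 1) P' P, 2 + c + c', max C C', fun q hq a ⟨p', hp', ha⟩ => ?_⟩
    have hq2 : 2 ≤ q := hq.out.two_le
    have hQ : 0 ≤ Real.log q := Real.log_natCast_nonneg q
    have hsize1 : 1 ≤ q.size := Nat.size_pos.2 (by omega)
    have hcube : q.size ≤ q.size ^ 3 := Nat.le_self_pow (by norm_num) _
    have hin : input a (j + 1) = ((a (Fin.castLE (by omega) p)).val : ℤ) :=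
      inputVars_coordIdx a p
    have hbits : bits (input a (j + 1)) ≤ q.size + 1 :=
      bits_le_of_natAbs_lt (natAbs_inputVars_lt a (coordIdx p))
    by_cases hp : a (Fin.castLE (by omega) p) = 0
    · have hp'j : (p' : ℕ) < j := by
        refine (Nat.lt_succ_iff_lt_or_eq.1 hp').resolve_right fun heq => ha ?_
        rwa [show p' = p from Fin.ext heq]
      obtain ⟨t, y, ⟨s', hs', h1, h2⟩, ht, hy⟩ := h q a ⟨p', hp'j, ha⟩
      refine ⟨_, y, ⟨s', .cond_nonpos ?_ hs', h1, h2⟩, ?_, hy.trans ?_⟩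
      · rw [hin, hp, ZMod.val_zero, Nat.cast_zero]
      · nlinarith [Nat.zero_le (c' * q.size ^ 3)]
      · exact div_le_div_of_nonneg_right (le_max_left _ _) hQ
    · obtain ⟨t, y, ⟨s', hs', h1, h2⟩, ht, hy⟩ := h' q a hp
      refine ⟨_, y, ⟨s', .cond_pos ?_ hs', h1, h2⟩, ?_, hy.trans ?_⟩
      · rw [hin]
        exact_mod_cast Nat.pos_of_ne_zero ((ZMod.val_ne_zero _).2 hp)
      · nlinarith [Nat.zero_le (c * q.size ^ 3)]
      · exact div_le_div_of_nonneg_right (le_max_right _ _) hQ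

theorem exists_ne_zero_of_mem_subsphere {q : ℕ} [Fact q.Prime] {a : Fin (d + 1) → ZMod q}
    (ha : a ∈ subsphere d (ZMod q)) : ∃ p : Fin (d - 1), a (Fin.castLE (by omega) p) ≠ 0 := by
  by_contra! h
  have hall : ∀ i, a i = 0 := by
    intro i
    by_cases hi : d - 1 ≤ (i : ℕ)
    · exact ha.2 i hi
    · exact h ⟨i, by omega⟩
  have h1 : ∑ i, a i ^ 2 = 1 := ha.1
  simp [hall] at h1

end

end LabelAlgorithm

theorem theorem1p3 (d : ℕ) (hd : 3 ≤ d) :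
    ∃ (P : LabelAlgorithm.Program) (k : ℕ) (K C : ℝ),
      ∀ (q : ℕ), q.Prime → ∀ a ∈ LabelAlgorithm.subsphere d (ZMod q),
        ∃ (t : ℕ) (y : ℚ),
          LabelAlgorithm.Returns P (LabelAlgorithm.input a) t y ∧
          (t : ℝ) ≤ K * Real.log q ^ k ∧
          |(y : ℝ) - LabelAlgorithm.eta a| ≤ C / Real.log q := by
  obtain ⟨P, c, C, h⟩ := LabelAlgorithm.exists_program_of_exists_pivot hd (d - 1) le_rfl
  refine ⟨P, 3, c * (2 / Real.log 2) ^ 3, C, fun q hq a ha => ?_⟩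
  have : Fact q.Prime := ⟨hq⟩
  obtain ⟨p, hp⟩ := LabelAlgorithm.exists_ne_zero_of_mem_subsphere ha
  obtain ⟨t, y, hret, ht, hy⟩ := h q a ⟨p, p.2, hp⟩
  refine ⟨t, y, hret, ?_, hy⟩
  have h2 : 0 < Real.log 2 := Real.log_pos (by norm_num)
  have hq2 : Real.log 2 ≤ Real.log q :=
    Real.log_le_log (by norm_num) (by exact_mod_cast hq.two_le)
  have hsize : (q.size : ℝ) ≤ 2 / Real.log 2 * Real.log q := by
    have h3 := LabelAlgorithm.size_sub_one_mul_le_log q hq.pos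
    rw [div_mul_eq_mul_div, le_div_iff₀ h2]
    linarith
  calc (t : ℝ) ≤ c * (q.size : ℝ) ^ 3 := by exact_mod_cast ht
    _ ≤ c * (2 / Real.log 2 * Real.log q) ^ 3 := by gcongr
    _ = c * (2 / Real.log 2) ^ 3 * Real.log q ^ 3 := by ring
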